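/- **Setting.** Let $(X,\mu)$ be a measure space and let $S$ be an $n$-dimensional smooth (Hausdorff) statistical manifold: each $q\in S$ is assigned a strictly positive probability density $p(\cdot\,;q)$ on $(X,\mu)$, smooth in $q$ for each $x\in X$. Put $l=\log p$ and let $E$ be the expectation with respect to $p(\cdot\,;q)$. In every coordinate chart the expectations $E[\partial_il\,\partial_jl]$, $E[\partial_i\partial_jl\,\partial_kl]$, $E[\partial_il\,\partial_jl\,\partial_kl]$ are assumed to exist and to be smooth, and the Fisher metric $\langle A,B\rangle=E[(Al)(Bl)]$ is assumed to be positive definite. For $\alpha\in\mathbb R$ the $\alpha$-connection is given by $$\langle\nabla^{(\alpha)}_AB,C\rangle=E[(ABl)(Cl)]+\tfrac{1-\alpha}{2}E[(Al)(Bl)(Cl)],$$ and $\nabla^{(\alpha)}_{\gamma'}\gamma'$ along a curve $\gamma$ is given by the same formula with $A=B=\gamma'$, where $\gamma'\gamma'l=\frac{d^2}{dt^2}\,l(x;\gamma(t))$. In a chart write $\Gamma_{ijk}=\langle\nabla^{(\alpha)}_{\partial_i}\partial_j,\partial_k\rangle$, $\Gamma_{ij}^k=\sum_s\Gamma_{ijs}g^{sk}$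 and $$R^{(\alpha)}_{ijkl}=\sum_s(\partial_j\Gamma_{ik}^s-\partial_i\Gamma_{jk}^s)g_{sl}+\sum_t(\Gamma_{jtl}\Gamma_{ik}^t-\Gamma_{itl}\Gamma_{jk}^t).$$ $(S,\nabla^{(\alpha)})$ is *torsion free* if $\nabla^{(\alpha)}_AB-\nabla^{(\alpha)}_BA-[A,B]=0$ for all smooth vector fields $A,B$, and *flat* if $R^{(\alpha)}_{ijkl}=0$ everywhere, in all charts. Let $\pi:F(S)\to S$ be the frame bundle, whose points over $q$ are the linear isomorphisms $u:\mathbb R^n\to T_qS$, with canonical form $\theta(Y)=u^{-1}(\pi_*Y)$ for $Y\in T_uF(S)$. Over the domain of a chart let $\phi(u)\in GL(n,\mathbb R)$ be the matrix of $u$ in the coordinate basis and let $\omega^{(\alpha)}$ be the matrix of one-forms with entry $\sum_i\Gamma_{ij}^k\,dx^i$ in row $k$ and column $j$. The connection form $\widetilde\omega^{(\alpha)}$ on $F(S)$ is given over that domain by $\mathrm{Ad}(\phi^{-1})\,\pi^*\omega^{(\alpha)}+\phi^{-1}d\phi$. Let $H^{(\alpha)}=\ker\widetilde\omega^{(\alpha)}$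 be the horizontal distribution, $h^{(\alpha)}$ the projection onto it along $\ker\pi_*$, $\Theta^{(\alpha)}=d\theta\circ h^{(\alpha)}$, and $\Omega^{(\alpha)}=d\widetilde\omega^{(\alpha)}\circ h^{(\alpha)}$. For $A,B,C\in T_qS$ and $u\in\pi^{-1}(q)$, with $\widetilde A,\widetilde B$ the horizontal lifts of $A,B$ to $u$, put $$T^{(\alpha)}(A,B)=u\bigl(\Theta^{(\alpha)}(\widetilde A,\widetilde B)\bigr),\qquad R^{(\alpha)}(A,B)C=u\bigl(\Omega^{(\alpha)}(\widetilde A,\widetilde B)\,u^{-1}C\bigr).$$ **Statement.** For every $\alpha\in\mathbb R$: 1. Let $\varepsilon>0$, let $\gamma:(-\varepsilon,\varepsilon)\to S$ be a smooth curve and let $\widetilde\gamma$ be any smooth horizontal lift of $\gamma$ to $F(S)$ with respect to $H^{(\alpha)}$. Then $\gamma$ is an $\alpha$-geodesic, that is, $\nabla^{(\alpha)}_{\gamma'}\gamma'=0$ on $(-\varepsilon,\varepsilon)$, if and only if $\widetilde\gamma'(\theta(\widetilde\gamma'))=0$, that is, $\frac{d}{dt}\,\theta(\widetilde\gamma'(t))=0$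 for all $t\in(-\varepsilon,\varepsilon)$. 2. The following are equivalent: (a) $(S,\nabla^{(\alpha)})$ is torsion free; (b) $T^{(\alpha)}=0$ (at all points and for all frames $u$); (c) $\Theta^{(\alpha)}=0$ on $F(S)$. 3. The following are equivalent: (a) $(S,\nabla^{(\alpha)})$ is flat; (b) $\nabla^{(\alpha)}_A\nabla^{(\alpha)}_BC-\nabla^{(\alpha)}_B\nabla^{(\alpha)}_AC-\nabla^{(\alpha)}_{[A,B]}C=0$ for all smooth vector fields $A,B,C$ on $S$; (c) $R^{(\alpha)}=0$ (at all points and for all frames $u$); (d) $\Omega^{(\alpha)}=0$ on $F(S)$. -/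

import Mathlib

open scoped Manifold ContDiff Topology
open MeasureTheory Set

namespace AlphaFrame

/-- The coordinate space `ℝⁿ`. -/
abbrev Coord (n : ℕ) : Type := EuclideanSpace ℝ (Fin n)

/-- The Lie algebra `gl(n, ℝ)`, as endomorphisms of `ℝⁿ`. -/
abbrev Gl (n : ℕ) : Type := Coord n →L[ℝ] Coord n

/-- The frame bundle `F(M)`: a point is a point `base` of `M` with a linear frame there, that is, a
linear isomorphism `u : ℝⁿ → T_base M` (the image of the standard basis is the basis in question);
the field `base` is the bundle projection `π : F(M) → M`. -/
structure FrameBundle (n : ℕ) (M : Type*) [TopologicalSpace M] [ChartedSpace (Coord n) M] where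
  base : M
  frame : Coord n ≃L[ℝ] TangentSpace (𝓡 n) base

variable {n : ℕ} {M : Type*} [TopologicalSpace M] [ChartedSpace (Coord n) M]

namespace FrameBundle

/-- The matrix of the frame `u` in the coordinate basis of the chart `e`: the fibre component
`φ_e : π⁻¹(U_e) → GL(n, ℝ)` of the local trivialization of `F(M)` over the domain of `e`. -/
noncomputable def matrixIn (e : OpenPartialHomeomorph M (Coord n)) (u : FrameBundle n M) : Gl n :=
  (mfderiv (𝓡 n) (𝓡 n) e u.base : TangentSpace (𝓡 n) u.base →L[ℝ] Coord n) ∘L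
    (u.frame : Coord n →L[ℝ] TangentSpace (𝓡 n) u.base)

theorem ext_of_matrixIn [IsManifold (𝓡 n) ∞ M] {e : OpenPartialHomeomorph M (Coord n)}
    (he : e ∈ atlas (Coord n) M) {u v : FrameBundle n M} (hu : u.base ∈ e.source)
    (hb : u.base = v.base) (hm : matrixIn e u = matrixIn e v) : u = v := by
  have : IsManifold (𝓡 n) 1 M := IsManifold.of_le (n := ∞) (by norm_num)
  obtain ⟨q, f⟩ := u
  obtain ⟨q', f'⟩ := v
  obtain rfl : q = q' := hb
  congr 1
  ext1; ext1 ξ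
  exact ((mdifferentiable_of_mem_atlas (I := 𝓡 n) he).mfderiv_injective hu) (DFunLike.congr_fun hm ξ)

open Classical in
/-- The frame with prescribed base point and invertible matrix in the chart `e` (junk elsewhere). -/
noncomputable def ofMatrix [IsManifold (𝓡 n) ∞ M] (e : OpenPartialHomeomorph M (Coord n))
    (he : e ∈ atlas (Coord n) M) (z : Coord n × Gl n) : FrameBundle n M :=
  haveI : IsManifold (𝓡 n) 1 M := IsManifold.of_le (n := ∞) (by norm_num)
  if h : z.1 ∈ e.target ∧ z.2.IsInvertible then
    ⟨e.symm z.1, h.2.choose.trans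
      ((mdifferentiable_of_mem_atlas (I := 𝓡 n) he).symm.mfderiv (x := z.1) h.1)⟩
  else ⟨e.symm z.1, ContinuousLinearEquiv.refl ℝ (Coord n)⟩

theorem ofMatrix_base [IsManifold (𝓡 n) ∞ M] (e : OpenPartialHomeomorph M (Coord n))
    (he : e ∈ atlas (Coord n) M) (z : Coord n × Gl n) : (ofMatrix e he z).base = e.symm z.1 := by
  unfold ofMatrix
  split_ifs <;> rfl

theorem matrixIn_ofMatrix [IsManifold (𝓡 n) ∞ M] (e e' : OpenPartialHomeomorph M (Coord n))
    (he : e ∈ atlas (Coord n) M) (he' : e' ∈ atlas (Coord n) M) {z : Coord n × Gl n}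
    (h : z.1 ∈ e.target) (h' : e.symm z.1 ∈ e'.source) (hz : z.2.IsInvertible) :
    matrixIn e' (ofMatrix e he z) = (fderiv ℝ (e' ∘ e.symm) z.1) ∘L z.2 := by
  have : IsManifold (𝓡 n) 1 M := IsManifold.of_le (n := ∞) (by norm_num)
  have hh : z.1 ∈ e.target ∧ z.2.IsInvertible := ⟨h, hz⟩
  have hc : (hz.choose : Gl n) = z.2 := hz.choose_spec
  have hd := mfderiv_comp (I := 𝓡 n) (I' := 𝓡 n) (I'' := 𝓡 n) z.1
    ((mdifferentiable_of_mem_atlas (I := 𝓡 n) he').mdifferentiableAt h')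
    ((mdifferentiable_of_mem_atlas (I := 𝓡 n) he).mdifferentiableAt_symm h)
  rw [mfderiv_eq_fderiv] at hd
  unfold ofMatrix
  rw [dif_pos hh]
  ext1 ξ
  have h1 : z.2 ξ = hz.choose ξ := (DFunLike.congr_fun hc ξ).symm
  change _ = fderiv ℝ (e' ∘ e.symm) z.1 (z.2 ξ)
  rw [h1]
  exact (DFunLike.congr_fun hd (hz.choose ξ)).symm

theorem matrixIn_isInvertible [IsManifold (𝓡 n) ∞ M] {e : OpenPartialHomeomorph M (Coord n)}
    (he : e ∈ atlas (Coord n) M) {u : FrameBundle n M} (hu : u.base ∈ e.source) :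
    (matrixIn e u).IsInvertible := by
  have : IsManifold (𝓡 n) 1 M := IsManifold.of_le (n := ∞) (by norm_num)
  exact ⟨u.frame.trans ((mdifferentiable_of_mem_atlas (I := 𝓡 n) he).mfderiv hu), rfl⟩

theorem ofMatrix_matrixIn [IsManifold (𝓡 n) ∞ M] {e : OpenPartialHomeomorph M (Coord n)}
    (he : e ∈ atlas (Coord n) M) {u : FrameBundle n M} (hu : u.base ∈ e.source) :
    ofMatrix e he (e u.base, matrixIn e u) = u := by
  have hb : (ofMatrix e he (e u.base, matrixIn e u)).base = u.base := by
    rw [ofMatrix_base]; exact e.left_inv hu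
  refine ext_of_matrixIn he (by rw [hb]; exact hu) hb ?_
  rw [matrixIn_ofMatrix e e he he (e.map_source hu) (by simpa [e.left_inv hu] using hu)
    (matrixIn_isInvertible he hu)]
  have : fderiv ℝ (e ∘ e.symm) (e u.base) = ContinuousLinearMap.id ℝ (Coord n) := by
    rw [← fderiv_id (𝕜 := ℝ) (x := e u.base)]
    apply Filter.EventuallyEq.fderiv_eq
    filter_upwards [e.open_target.mem_nhds (e.map_source hu)] with y hy
    exact e.right_inv hy
  rw [this, ContinuousLinearMap.id_comp]

/-- The chart `u ↦ (e (π u), φ_e u)` of `F(M)` on `π⁻¹(U_e)`, with values in `ℝⁿ × gl(n, ℝ)`. -/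
noncomputable def liftChart [IsManifold (𝓡 n) ∞ M] (e : OpenPartialHomeomorph M (Coord n))
    (he : e ∈ atlas (Coord n) M) : PartialEquiv (FrameBundle n M) (Coord n × Gl n) where
  toFun u := (e u.base, matrixIn e u)
  invFun := ofMatrix e he
  source := {u | u.base ∈ e.source}
  target := e.target ×ˢ {A : Gl n | A.IsInvertible}
  map_source' u hu := ⟨e.map_source hu, matrixIn_isInvertible he hu⟩
  map_target' z hz := by
    change (ofMatrix e he z).base ∈ e.source
    rw [ofMatrix_base]; exact e.map_target hz.1
  left_inv' u hu := ofMatrix_matrixIn he hu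
  right_inv' z hz := by
    have h1 := e.map_target hz.1
    refine Prod.ext ?_ ?_
    · change e (ofMatrix e he z).base = z.1
      rw [ofMatrix_base]; exact e.right_inv hz.1
    · change matrixIn e (ofMatrix e he z) = z.2
      rw [matrixIn_ofMatrix e e he he hz.1 h1 hz.2]
      have : fderiv ℝ (e ∘ e.symm) z.1 = ContinuousLinearMap.id ℝ (Coord n) := by
        rw [← fderiv_id (𝕜 := ℝ) (x := z.1)]
        apply Filter.EventuallyEq.fderiv_eq
        filter_upwards [e.open_target.mem_nhds hz.1] with y hy
        exact e.right_inv hy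
      rw [this, ContinuousLinearMap.id_comp]

section transition
variable [IsManifold (𝓡 n) ∞ M] {e e' : OpenPartialHomeomorph M (Coord n)}
    (he : e ∈ atlas (Coord n) M) (he' : e' ∈ atlas (Coord n) M)

theorem transition_source : ((liftChart e he).symm.trans (liftChart e' he')).source =
    (e.symm.trans e').source ×ˢ {A : Gl n | A.IsInvertible} := by
  ext z
  have : (ofMatrix e he z).base ∈ e'.source ↔ e.symm z.1 ∈ e'.source := by rw [ofMatrix_base]
  simp only [PartialEquiv.trans_source, PartialEquiv.symm_source, OpenPartialHomeomorph.trans_source,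
    OpenPartialHomeomorph.symm_source, mem_inter_iff, mem_preimage, mem_prod, mem_ofPred_eq]
  change (z.1 ∈ e.target ∧ z.2.IsInvertible) ∧ (ofMatrix e he z).base ∈ e'.source ↔ 
    (z.1 ∈ e.target ∧ e.symm z.1 ∈ e'.source) ∧ z.2.IsInvertible
  rw [this]; tauto

theorem transition_open :
    IsOpen ((liftChart e he).symm.trans (liftChart e' he')).source := by
  rw [transition_source]
  refine (e.symm.trans e').open_source.prod ?_
  exact ContinuousLinearEquiv.isOpen (𝕜 := ℝ) (E := Coord n) (F := Coord n)

theorem transition_contDiffOn :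
    ContDiffOn ℝ ∞ ((liftChart e he).symm.trans (liftChart e' he'))
      ((liftChart e he).symm.trans (liftChart e' he')).source := by
  have hτ : ContDiffOn ℝ ∞ (e' ∘ e.symm) (e.symm.trans e').source := by
    have := HasGroupoid.compatible (G := contDiffGroupoid ∞ (𝓡 n)) he he'
    have := (contDiffGroupoid ∞ (𝓡 n)).mem_iff_of_eqOnSource (OpenPartialHomeomorph.eqOnSource_refl _) |>.1 this
    rw [contDiffGroupoid, mem_groupoid_of_pregroupoid] at this
    simpa [contDiffPregroupoid] using this.1
  have ho := (e.symm.trans e').open_source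
  have hf : ContDiffOn ℝ ∞ (fun z : Coord n × Gl n =>
      (((e' ∘ e.symm) z.1, (fderiv ℝ (e' ∘ e.symm) z.1) ∘L z.2) : Coord n × Gl n))
      ((e.symm.trans e').source ×ˢ {A : Gl n | A.IsInvertible}) := by
    have h1 : ContDiffOn ℝ ∞ (fderiv ℝ (e' ∘ e.symm)) (e.symm.trans e').source :=
      hτ.fderiv_of_isOpen ho (by norm_num)
    refine (hτ.comp contDiff_fst.contDiffOn fun z hz => hz.1).prodMk ?_
    exact (h1.comp contDiff_fst.contDiffOn fun z hz => hz.1).clm_comp contDiff_snd.contDiffOn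
  rw [transition_source]
  refine hf.congr fun z hz => ?_
  have h1 : z.1 ∈ e.target ∧ e.symm z.1 ∈ e'.source := by simpa using hz.1
  refine Prod.ext ?_ ?_
  · change e' (ofMatrix e he z).base = _
    rw [ofMatrix_base]; rfl
  · exact matrixIn_ofMatrix e e' he he' h1.1 h1.2 hz.2

end transition

/-- The smooth atlas of `F(M)`, made of the lifts of the charts of `M`. -/
noncomputable def core (n : ℕ) (M : Type*) [TopologicalSpace M] [ChartedSpace (Coord n) M]
    [IsManifold (𝓡 n) ∞ M] : ChartedSpaceCore (Coord n × Gl n) (FrameBundle n M) where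
  atlas := {φ | ∃ (e : OpenPartialHomeomorph M (Coord n)) (he : e ∈ atlas (Coord n) M),
    φ = liftChart e he}
  chartAt u := liftChart (chartAt (Coord n) u.base) (chart_mem_atlas _ _)
  mem_chart_source u := mem_chart_source (Coord n) u.base
  chart_mem_atlas u := ⟨_, chart_mem_atlas _ _, rfl⟩
  open_source := by
    rintro _ _ ⟨e, he, rfl⟩ ⟨e', he', rfl⟩
    exact transition_open he he'
  continuousOn_toFun := by
    rintro _ _ ⟨e, he, rfl⟩ ⟨e', he', rfl⟩
    exact (transition_contDiffOn he he').continuousOn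

noncomputable instance [IsManifold (𝓡 n) ∞ M] : TopologicalSpace (FrameBundle n M) :=
  (core n M).toTopologicalSpace

noncomputable instance [IsManifold (𝓡 n) ∞ M] :
    ChartedSpace (Coord n × Gl n) (FrameBundle n M) :=
  (core n M).toChartedSpace

instance [IsManifold (𝓡 n) ∞ M] : IsManifold 𝓘(ℝ, Coord n × Gl n) ∞ (FrameBundle n M) := by
  apply isManifold_of_contDiffOn
  intro φ ψ hφ hψ
  obtain ⟨_, ⟨_, rfl⟩, hφ⟩ := hφ
  obtain ⟨_, ⟨_, rfl⟩, hψ⟩ := hψ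
  obtain ⟨_, ⟨⟨e, he, rfl⟩, rfl⟩, rfl⟩ := hφ
  obtain ⟨_, ⟨⟨e', he', rfl⟩, rfl⟩, rfl⟩ := hψ
  simpa using! transition_contDiffOn he he'

end FrameBundle

/-! ### The exterior derivative of a vector-valued one-form on a manifold -/

/-- The exterior derivative `dη` of an `F`-valued one-form `η` on a manifold `P`, computed in the
preferred chart `φ` at `u`: `dη(v, w) = ∂_v (η(w)) - ∂_w (η(v))`, where `v`, `w` are extended by
constants in the chart. This is the normalization
`dη(X, Y) = X(η(Y)) - Y(η(X)) - η([X, Y])`. -/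
noncomputable def dOneForm {V : Type*} [NormedAddCommGroup V] [NormedSpace ℝ V]
    {F : Type*} [NormedAddCommGroup F] [NormedSpace ℝ F]
    {P : Type*} [TopologicalSpace P] [ChartedSpace V P]
    (η : (u : P) → TangentSpace 𝓘(ℝ, V) u →L[ℝ] F) (u : P) (v w : TangentSpace 𝓘(ℝ, V) u) : F :=
  let φ := chartAt V u
  let comp : V → V → F := fun a y => η (φ.symm y) (mfderiv 𝓘(ℝ, V) 𝓘(ℝ, V) φ.symm y a)
  let v₀ : V := mfderiv 𝓘(ℝ, V) 𝓘(ℝ, V) φ u v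
  let w₀ : V := mfderiv 𝓘(ℝ, V) 𝓘(ℝ, V) φ u w
  fderiv ℝ (comp w₀) (φ u) v₀ - fderiv ℝ (comp v₀) (φ u) w₀

/-! ### Statistical manifolds -/

section Density

variable {X : Type*}

/-- `A l` for a tangent vector `A` at `q`: the derivative of the log-likelihood
`l(x; ·) = log p(x; ·)` along `A`, as a function of the sample `x`. -/
noncomputable def score (p : M → X → ℝ) (q : M) (A : TangentSpace (𝓡 n) q) (x : X) : ℝ :=
  mfderiv (𝓡 n) 𝓘(ℝ, ℝ) (fun q' => Real.log (p q' x)) q A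

/-- `A (B l)` at `q` for vector fields `A`, `B`, as a function of the sample `x`. -/
noncomputable def score₂ (p : M → X → ℝ) (A B : (q : M) → TangentSpace (𝓡 n) q) (q : M)
    (x : X) : ℝ :=
  mfderiv (𝓡 n) 𝓘(ℝ, ℝ) (fun q' => score p q' (B q') x) q (A q)

/-- `E[f]` with respect to the density `p(·; q)`. -/
noncomputable def expect [MeasurableSpace X] (μ : Measure X) (p : M → X → ℝ) (q : M)
    (f : X → ℝ) : ℝ :=
  ∫ x, f x * p q x ∂μ

/-- The coordinate vector `∂ᵢ` of `ℝⁿ`. -/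
noncomputable def dirVec (i : Fin n) : Coord n := EuclideanSpace.single i 1

/-- `∂ᵢ l` in the chart `e`, at the point with coordinates `y`. -/
noncomputable def dl (p : M → X → ℝ) (e : OpenPartialHomeomorph M (Coord n)) (i : Fin n)
    (y : Coord n) (x : X) : ℝ :=
  fderiv ℝ (fun z => Real.log (p (e.symm z) x)) y (dirVec i)

/-- `∂ᵢ ∂ⱼ l` in the chart `e`, at the point with coordinates `y`. -/
noncomputable def ddl (p : M → X → ℝ) (e : OpenPartialHomeomorph M (Coord n)) (i j : Fin n)
    (y : Coord n) (x : X) : ℝ :=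
  fderiv ℝ (fun z => dl p e j z x) y (dirVec i)

end Density

/-- An `n`-dimensional statistical manifold: a smooth manifold `M` parametrizing a family of
positive probability densities `p(x; q)`, `q ∈ M`, on a measure space `(X, μ)`. The case of an
open set `Θ ⊆ ℝⁿ` of parameters is the one of a single chart.

The regularity conditions are those that give a meaning to the Fisher metric and to the
`α`-connections as smooth objects: `p` is smooth in the parameter, the expectations
`E[∂ᵢl ∂ⱼl]`, `E[∂ᵢ∂ⱼl ∂ₖl]`, `E[∂ᵢl ∂ⱼl ∂ₖl]` exist and are smooth functions of the coordinates,
and the Fisher metric is positive definite. -/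
structure StatisticalManifold (n : ℕ) (M : Type*) [TopologicalSpace M] [ChartedSpace (Coord n) M]
    {X : Type*} [MeasurableSpace X] (μ : Measure X) where
  /-- the density `p(x; q)`, written `p q x` -/
  p : M → X → ℝ
  pos : ∀ q x, 0 < p q x
  integrable : ∀ q, Integrable (p q) μ
  integral_eq_one : ∀ q, ∫ x, p q x ∂μ = 1
  smooth : ∀ x, ContMDiff (𝓡 n) 𝓘(ℝ, ℝ) ∞ (fun q => p q x)
  integrable₂ : ∀ e ∈ atlas (Coord n) M, ∀ y ∈ e.target, ∀ i j : Fin n,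
    Integrable (fun x => dl p e i y x * dl p e j y x * p (e.symm y) x) μ
  smooth₂ : ∀ e ∈ atlas (Coord n) M, ∀ i j : Fin n,
    ContDiffOn ℝ ∞ (fun y => expect μ p (e.symm y) fun x => dl p e i y x * dl p e j y x) e.target
  integrable₂₁ : ∀ e ∈ atlas (Coord n) M, ∀ y ∈ e.target, ∀ i j k : Fin n,
    Integrable (fun x => ddl p e i j y x * dl p e k y x * p (e.symm y) x) μ
  smooth₂₁ : ∀ e ∈ atlas (Coord n) M, ∀ i j k : Fin n,
    ContDiffOn ℝ ∞ (fun y => expect μ p (e.symm y) fun x => ddl p e i j y x * dl p e k y x)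
      e.target
  integrable₃ : ∀ e ∈ atlas (Coord n) M, ∀ y ∈ e.target, ∀ i j k : Fin n,
    Integrable (fun x => dl p e i y x * dl p e j y x * dl p e k y x * p (e.symm y) x) μ
  smooth₃ : ∀ e ∈ atlas (Coord n) M, ∀ i j k : Fin n,
    ContDiffOn ℝ ∞ (fun y => expect μ p (e.symm y) fun x =>
      dl p e i y x * dl p e j y x * dl p e k y x) e.target
  fisher_pos : ∀ (q : M) (A : TangentSpace (𝓡 n) q), A ≠ 0 →
    0 < expect μ p q fun x => score p q A x * score p q A x

namespace StatisticalManifold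

variable {X : Type*} [MeasurableSpace X] {μ : Measure X} (S : StatisticalManifold n M μ) (α : ℝ)

/-! ### Fisher metric and the connection `∇^(α)` on the base -/

/-- The Fisher metric `⟨A, B⟩ = E[(A l)(B l)]`. -/
noncomputable def fisher (q : M) (A B : TangentSpace (𝓡 n) q) : ℝ :=
  expect μ S.p q fun x => score S.p q A x * score S.p q B x

/-- The tangent vector `Z` at `q` determined by `⟨Z, C⟩ = ℓ(C)` for all `C`. -/
noncomputable def raise (q : M) (ℓ : TangentSpace (𝓡 n) q → ℝ) : TangentSpace (𝓡 n) q :=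
  Classical.epsilon fun Z => ∀ C, S.fisher q Z C = ℓ C

/-- The `α`-connection: `⟨∇_A B, C⟩ = E[(A B l)(C l)] + (1 - α)/2 E[(A l)(B l)(C l)]`. -/
noncomputable def nabla (A B : (q : M) → TangentSpace (𝓡 n) q) (q : M) : TangentSpace (𝓡 n) q :=
  S.raise q fun C =>
    expect μ S.p q (fun x => score₂ S.p A B q x * score S.p q C x) +
      (1 - α) / 2 *
        expect μ S.p q (fun x => score S.p q (A q) x * score S.p q (B q) x * score S.p q C x)

/-- The velocity `γ'(t)` of a curve in `M`. -/
noncomputable def velocity (γ : ℝ → M) (t : ℝ) : TangentSpace (𝓡 n) (γ t) :=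
  mfderiv 𝓘(ℝ, ℝ) (𝓡 n) γ t (1 : ℝ)

/-- `∇_{γ'} γ'` at time `t`: the formula for `∇_A B` with `A = B = γ'`, where
`γ'(t)(γ' l) = d/dt (γ'(t) l)`. -/
noncomputable def nablaVelocity (γ : ℝ → M) (t : ℝ) : TangentSpace (𝓡 n) (γ t) :=
  S.raise (γ t) fun C =>
    expect μ S.p (γ t)
        (fun x => deriv (fun s => score (n := n) S.p (γ s) (velocity (n := n) γ s) x) t * score S.p (γ t) C x) +
      (1 - α) / 2 *
        expect μ S.p (γ t) (fun x => score S.p (γ t) (velocity (n := n) γ t) x *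
          score S.p (γ t) (velocity (n := n) γ t) x * score S.p (γ t) C x)

/-- A curve is an `α`-geodesic on `J` if `∇_{γ'} γ' = 0` there. -/
def IsGeodesicOn (γ : ℝ → M) (J : Set ℝ) : Prop :=
  ∀ t ∈ J, S.nablaVelocity α γ t = 0

/-- A smooth vector field on `M`. -/
def IsSmoothField (A : (q : M) → TangentSpace (𝓡 n) q) [IsManifold (𝓡 n) ∞ M] : Prop :=
  ContMDiff (𝓡 n) (𝓡 n).tangent ∞ fun q => (⟨q, A q⟩ : TangentBundle (𝓡 n) M)

/-- `(S, ∇^(α))` is torsion free: `∇_A B - ∇_B A - [A, B] = 0` for all vector fields `A`, `B`. -/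
def TorsionFree [IsManifold (𝓡 n) ∞ M] : Prop :=
  ∀ A B : (q : M) → TangentSpace (𝓡 n) q, IsSmoothField A → IsSmoothField B → ∀ q,
    S.nabla α A B q - S.nabla α B A q - VectorField.mlieBracket (𝓡 n) A B q = 0

/-- `∇_A ∇_B C - ∇_B ∇_A C - ∇_[A, B] C` for vector fields `A`, `B`, `C`. -/
noncomputable def curvature (A B C : (q : M) → TangentSpace (𝓡 n) q) (q : M) :
    TangentSpace (𝓡 n) q :=
  S.nabla α A (S.nabla α B C) q - S.nabla α B (S.nabla α A C) q -
    S.nabla α (VectorField.mlieBracket (𝓡 n) A B) C q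

/-! ### Coordinate expressions in a chart -/

section Chart

variable (e : OpenPartialHomeomorph M (Coord n))

/-- The Fisher information matrix `gᵢⱼ = E[∂ᵢl ∂ⱼl]` at the point with coordinates `y`. -/
noncomputable def metricMatrix (y : Coord n) : Matrix (Fin n) (Fin n) ℝ :=
  Matrix.of fun i j => expect μ S.p (e.symm y) fun x => dl S.p e i y x * dl S.p e j y x

/-- `Γᵢⱼₖ = ⟨∇_{∂ᵢ} ∂ⱼ, ∂ₖ⟩ = E[∂ᵢ∂ⱼl ∂ₖl] + (1 - α)/2 E[∂ᵢl ∂ⱼl ∂ₖl]`. -/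
noncomputable def christoffelLow (i j k : Fin n) (y : Coord n) : ℝ :=
  expect μ S.p (e.symm y) (fun x => ddl S.p e i j y x * dl S.p e k y x) +
    (1 - α) / 2 *
      expect μ S.p (e.symm y) (fun x => dl S.p e i y x * dl S.p e j y x * dl S.p e k y x)

/-- The coefficient of `∂ₖ` in `∇_{∂ᵢ} ∂ⱼ`, that is `∑ₛ Γᵢⱼₛ gˢᵏ`; symmetric in `i`, `j`. -/
noncomputable def christoffel (i j k : Fin n) (y : Coord n) : ℝ :=
  ∑ s, S.christoffelLow α e i j s y * (S.metricMatrix e y)⁻¹ s k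

/-- The coordinate components `R_{ijkl} = ⟨R(∂ⱼ, ∂ᵢ) ∂ₖ, ∂ₗ⟩` of the curvature tensor. -/
noncomputable def curvatureComp (i j k l : Fin n) (y : Coord n) : ℝ :=
  ∑ s, (fderiv ℝ (S.christoffel α e i k s) y (dirVec j) -
      fderiv ℝ (S.christoffel α e j k s) y (dirVec i)) * S.metricMatrix e y s l +
    ∑ t, (S.christoffelLow α e j t l y * S.christoffel α e i k t y -
      S.christoffelLow α e i t l y * S.christoffel α e j k t y)

/-- The `α`-connection form in the chart `e`: the `gl(n, ℝ)`-valued one-form whose matrix entry in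
row `k` and column `j` is `∑ᵢ Γᵢⱼᵏ dxⁱ` (the order of the two lower indices is immaterial). -/
noncomputable def connectionForm (y : Coord n) : Coord n →L[ℝ] Gl n :=
  ∑ i, (EuclideanSpace.proj i : Coord n →L[ℝ] ℝ).smulRight
    (Matrix.toEuclideanCLM (n := Fin n) (𝕜 := ℝ) (Matrix.of fun k j => S.christoffel α e i j k y))

end Chart

/-- `(S, ∇^(α))` is flat: all components `R_{ijkl}` vanish in all coordinate charts. -/
def Flat : Prop :=
  ∀ e ∈ atlas (Coord n) M, ∀ y ∈ e.target, ∀ i j k l : Fin n, S.curvatureComp α e i j k l y = 0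

end StatisticalManifold

/-! ### Geometry of the frame bundle -/

namespace FrameBundle

variable [IsManifold (𝓡 n) ∞ M]

/-- The tangent space `T_u F(M)`. -/
abbrev Tan (u : FrameBundle n M) : Type := TangentSpace 𝓘(ℝ, Coord n × Gl n) u

/-- The differential `π_*` of the projection `π : F(M) → M`. -/
noncomputable def projDiff (u : FrameBundle n M) : Tan u →L[ℝ] TangentSpace (𝓡 n) u.base :=
  mfderiv 𝓘(ℝ, Coord n × Gl n) (𝓡 n) (FrameBundle.base (n := n) (M := M)) u

/-- The canonical one-form `θ(Y) = u⁻¹(π_* Y)` on `F(M)`. -/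
noncomputable def canonicalForm (u : FrameBundle n M) : Tan u →L[ℝ] Coord n :=
  (u.frame.symm : TangentSpace (𝓡 n) u.base →L[ℝ] Coord n) ∘L projDiff u

/-- The velocity of a curve in `F(M)`. -/
noncomputable def velocity (c : ℝ → FrameBundle n M) (t : ℝ) : Tan (c t) :=
  mfderiv 𝓘(ℝ, ℝ) 𝓘(ℝ, Coord n × Gl n) c t (1 : ℝ)

end FrameBundle

namespace StatisticalManifold

open FrameBundle

variable [IsManifold (𝓡 n) ∞ M] {X : Type*} [MeasurableSpace X] {μ : Measure X}
  (S : StatisticalManifold n M μ) (α : ℝ)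

/-- The local form `Ad(φ_e⁻¹) ∘ π^* ω_e + φ_e^* (A⁻¹ dA)` on `π⁻¹(U_e)`, for a chart `e` of `M`,
with `ω_e` the `α`-connection form in `e` and `A⁻¹ dA` the canonical one-form of `GL(n, ℝ)`. -/
noncomputable def frameFormIn (e : OpenPartialHomeomorph M (Coord n)) (u : FrameBundle n M) :
    Tan u →L[ℝ] Gl n :=
  let A : Gl n := matrixIn e u
  let De : TangentSpace (𝓡 n) u.base →L[ℝ] Coord n := mfderiv (𝓡 n) (𝓡 n) e u.base
  let dA : Tan u →L[ℝ] Gl n :=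
    mfderiv 𝓘(ℝ, Coord n × Gl n) 𝓘(ℝ, Gl n) (matrixIn (n := n) (M := M) e) u
  (ContinuousLinearMap.compL ℝ (Coord n) (Coord n) (Coord n) A.inverse) ∘L
    (((ContinuousLinearMap.compL ℝ (Coord n) (Coord n) (Coord n)).flip A) ∘L
      (S.connectionForm α e (e u.base)) ∘L De ∘L (projDiff u) + dA)

/-- The connection form `ω̃^(α)` on `F(M)`; the local forms agree on overlaps, and the one of the
preferred chart at `π u` is used at `u`. -/
noncomputable def frameForm (u : FrameBundle n M) : Tan u →L[ℝ] Gl n :=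
  S.frameFormIn α (chartAt (Coord n) u.base) u

/-- The vertical subspace `V_u = ker π_*`. -/
noncomputable def vertical (u : FrameBundle n M) : Submodule ℝ (Tan u) :=
  LinearMap.ker (projDiff u).toLinearMap

/-- The horizontal subspace `H_u^(α) = ker ω̃^(α)`. -/
noncomputable def horizontal (u : FrameBundle n M) : Submodule ℝ (Tan u) :=
  LinearMap.ker (S.frameForm α u).toLinearMap

/-- The horizontal part `h(Y)` of `Y` in the decomposition `T_u F(M) = V_u ⊕ H_u`. -/
noncomputable def horPart (u : FrameBundle n M) (Y : Tan u) : Tan u :=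
  Classical.epsilon fun Z => Z ∈ S.horizontal α u ∧ Y - Z ∈ vertical u

/-- The horizontal lift at `u` of a tangent vector at `π u`. -/
noncomputable def horLift (u : FrameBundle n M) (A : TangentSpace (𝓡 n) u.base) : Tan u :=
  Classical.epsilon fun Z => Z ∈ S.horizontal α u ∧ projDiff u Z = A

/-- The `α`-torsion form `Θ^(α) = dθ ∘ h`. -/
noncomputable def torsionForm (u : FrameBundle n M) (Y Z : Tan u) : Coord n :=
  dOneForm (fun u : FrameBundle n M => canonicalForm u) u (S.horPart α u Y) (S.horPart α u Z)

/-- The `α`-curvature form `Ω^(α) = dω̃^(α) ∘ h`. -/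
noncomputable def curvatureForm (u : FrameBundle n M) (Y Z : Tan u) : Gl n :=
  dOneForm (fun u : FrameBundle n M => S.frameForm α u) u (S.horPart α u Y) (S.horPart α u Z)

/-- The torsion tensor `T(A, B) = u(Θ(Ã, B̃))` at `π u`, computed with the frame `u`. -/
noncomputable def torsionTensor (u : FrameBundle n M) (A B : TangentSpace (𝓡 n) u.base) :
    TangentSpace (𝓡 n) u.base :=
  u.frame (S.torsionForm α u (S.horLift α u A) (S.horLift α u B))

/-- The curvature tensor `R(A, B)C = u(Ω(Ã, B̃) u⁻¹(C))` at `π u`, computed with the frame `u`. -/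
noncomputable def curvatureTensor (u : FrameBundle n M) (A B C : TangentSpace (𝓡 n) u.base) :
    TangentSpace (𝓡 n) u.base :=
  u.frame (S.curvatureForm α u (S.horLift α u A) (S.horLift α u B) (u.frame.symm C))

/-- `c` is a smooth horizontal lift of `γ` on the set `J` of times. -/
structure IsHorizontalLiftOn (c : ℝ → FrameBundle n M) (γ : ℝ → M) (J : Set ℝ) : Prop where
  smooth : ContMDiffOn 𝓘(ℝ, ℝ) 𝓘(ℝ, Coord n × Gl n) ∞ c J
  base_eq : ∀ t ∈ J, (c t).base = γ t
  horizontal : ∀ t ∈ J, FrameBundle.velocity c t ∈ S.horizontal α (c t)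

end StatisticalManifold

end AlphaFrame

namespace AlphaFrame

variable {n : ℕ} {M : Type*} [TopologicalSpace M] [ChartedSpace (Coord n) M]

/-! Everything is compared in coordinates. Over a chart `e` write `x` for the base point, `A` for
the matrix of a frame (`matrixIn`), `ω` for `connectionForm`, and `F = dω + ω ∧ ω` for
`chartCurvature`.

On the base, positive definiteness of the Fisher metric turns the weak definition of `∇` into `∇_V W
= DW(V) + ω(V)W`, and likewise `∇_{γ'}γ'` into `x'' + ω(x')x'` (both from `chartDeriv_raise`). Hence
the vector-field curvature is `F` (`chartDeriv_curvature`), and the components `R_{ijkl}` are `F`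
with one index lowered by the invertible metric (`curvatureComp_eq`).

On the frame bundle, `θ = A⁻¹ dx` and `ω̃ = A⁻¹(ω(dx) A + dA)`, so horizontal vectors are those with
`dA = -ω(dx) A` (`mem_horizontal_iff`). Three computations follow. Geodesics: along a horizontal
curve `d/dt (A⁻¹x') = A⁻¹(x'' + ω(x')x')`, and `A` is invertible (`geodesic_iff`). Torsion: on
horizontal vectors `dθ` is `A⁻¹` times the antisymmetric part of `ω`. Second derivatives of the
log-likelihood commute, so `ω` is symmetric and all three torsion statements hold for every `α`
(`torsionFree`, `torsionForm_eq_zero`). Curvature: `Ω = A⁻¹ F A` on projected vectors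
(`curvatureForm_eq`), so all four flatness conditions say `F = 0`.

Two global points remain. The local forms of `ω̃` must agree on overlaps, because the preferred
chart varies with the point; this is `connectionForm_transition`. Every tangent vector must extend
to a global smooth field, which is `exists_smoothField_eq`. -/

theorem eq_sum_dirVec (v : Coord n) : v = ∑ i, v i • dirVec i := by
  ext j
  simp [dirVec, Pi.single_apply]

@[simp] theorem dirVec_apply (i j : Fin n) : (dirVec i : Coord n) j = if j = i then 1 else 0 := by
  simp [dirVec]

theorem map_eq_sum {F : Type*} [NormedAddCommGroup F] [NormedSpace ℝ F] (f : Coord n →L[ℝ] F)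
    (v : Coord n) : f v = ∑ i, v i • f (dirVec i) := by
  conv_lhs => rw [eq_sum_dirVec v]
  simp

/-- The differential of a chart. -/
noncomputable def chartDeriv (e : OpenPartialHomeomorph M (Coord n)) (q : M) :
    TangentSpace (𝓡 n) q →L[ℝ] Coord n :=
  mfderiv (𝓡 n) (𝓡 n) e q

/-- The coordinate expression of a vector field in a chart. -/
noncomputable def fieldRep (e : OpenPartialHomeomorph M (Coord n))
    (B : (q : M) → TangentSpace (𝓡 n) q) (z : Coord n) : Coord n :=
  chartDeriv e (e.symm z) (B (e.symm z))

theorem fieldRep_apply (e : OpenPartialHomeomorph M (Coord n))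
    (B : (q : M) → TangentSpace (𝓡 n) q) {q : M} (hq : q ∈ e.source) :
    fieldRep e B (e q) = chartDeriv e q (B q) := by
  unfold fieldRep
  rw [e.left_inv hq]

/-! ### Vector fields and Lie brackets in a chart. -/

section charts

variable [IsManifold (𝓡 n) ∞ M] {e : OpenPartialHomeomorph M (Coord n)}

theorem chart_mdifferentiable (he : e ∈ atlas (Coord n) M) : e.MDifferentiable (𝓡 n) (𝓡 n) := by
  have : IsManifold (𝓡 n) 1 M := IsManifold.of_le (n := ∞) (by norm_num)
  exact mdifferentiable_of_mem_atlas he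

theorem chartDeriv_bijective (he : e ∈ atlas (Coord n) M) {q : M} (hq : q ∈ e.source) :
    Function.Bijective (chartDeriv e q) :=
  (chart_mdifferentiable he).mfderiv_bijective hq

theorem chart_symm_contMDiffOn (he : e ∈ atlas (Coord n) M) :
    ContMDiffOn (𝓡 n) (𝓡 n) ∞ e.symm e.target :=
  contMDiffOn_symm_of_mem_maximalAtlas (IsManifold.subset_maximalAtlas he)

theorem chart_contMDiffOn (he : e ∈ atlas (Coord n) M) :
    ContMDiffOn (𝓡 n) (𝓡 n) ∞ e e.source :=
  contMDiffOn_of_mem_maximalAtlas (IsManifold.subset_maximalAtlas he)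

theorem mfderiv_eq_fderiv_comp_chart {F : Type*} [NormedAddCommGroup F] [NormedSpace ℝ F]
    (he : e ∈ atlas (Coord n) M) {q : M} (hq : q ∈ e.source) {f : M → F}
    (hf : DifferentiableAt ℝ (f ∘ e.symm) (e q)) (A : TangentSpace (𝓡 n) q) :
    mfderiv (𝓡 n) 𝓘(ℝ, F) f q A = fderiv ℝ (f ∘ e.symm) (e q) (chartDeriv e q A) := by
  have h1 : HasMFDerivAt (𝓡 n) 𝓘(ℝ, F) ((f ∘ e.symm) ∘ e) q
      ((fderiv ℝ (f ∘ e.symm) (e q)).comp (chartDeriv e q)) :=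
    HasMFDerivAt.comp q hf.hasFDerivAt.hasMFDerivAt
      ((chart_mdifferentiable he).mdifferentiableAt hq).hasMFDerivAt
  have h2 : f =ᶠ[𝓝 q] (f ∘ e.symm) ∘ e := by
    filter_upwards [e.open_source.mem_nhds hq] with y hy
    simp [e.left_inv hy]
  rw [(h1.congr_of_eventuallyEq h2).mfderiv]
  rfl

theorem mfderiv_symm_isInvertible (he : e ∈ atlas (Coord n) M) {z : Coord n} (hz : z ∈ e.target) :
    (mfderiv (𝓡 n) (𝓡 n) e.symm z).IsInvertible :=
  ⟨(chart_mdifferentiable he).symm.mfderiv (x := z) hz, rfl⟩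

theorem fieldRep_eq_mpullback (he : e ∈ atlas (Coord n) M)
    (B : (q : M) → TangentSpace (𝓡 n) q) {z : Coord n} (hz : z ∈ e.target) :
    fieldRep e B z = VectorField.mpullback (𝓡 n) (𝓡 n) e.symm B z := by
  rw [VectorField.mpullback_apply]
  refine ((mfderiv_symm_isInvertible he hz).inverse_apply_eq.2 ?_).symm
  have := (chart_mdifferentiable he).symm_comp_deriv (e.map_target hz)
  rw [e.right_inv hz] at this
  exact (DFunLike.congr_fun this (B (e.symm z))).symm

theorem fieldRep_contDiffOn (he : e ∈ atlas (Coord n) M)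
    {B : (q : M) → TangentSpace (𝓡 n) q} (hB : StatisticalManifold.IsSmoothField B) :
    ContDiffOn ℝ ∞ (fieldRep e B) e.target := by
  refine ContDiffOn.congr (f := VectorField.mpullback (𝓡 n) (𝓡 n) e.symm B) ?_
    fun z hz => fieldRep_eq_mpullback he B hz
  intro z hz
  refine (contMDiffAt_vectorSpace_iff_contDiffAt.1 ?_).contDiffWithinAt
  exact ContMDiffAt.mpullback_vectorField_preimage (n := ∞) (hB _)
    ((chart_symm_contMDiffOn he).contMDiffAt (e.open_target.mem_nhds hz))
    (mfderiv_symm_isInvertible he hz) (by simp)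

theorem mlieBracket_eq_fderiv (V W : Coord n → Coord n) (z : Coord n) :
    VectorField.mlieBracket (𝓡 n) V W z = fderiv ℝ W z (V z) - fderiv ℝ V z (W z) := by
  exact (congrFun VectorField.mlieBracketWithin_univ.symm z).trans
    ((congrFun VectorField.mlieBracketWithin_eq_lieBracketWithin z).trans
      (congrFun (VectorField.lieBracketWithin_univ (𝕜 := ℝ) (V := V) (W := W)) z))

/-- The bracket is natural under pullback by `e.symm`, and on a vector space it is the commutator of
directional derivatives. -/
theorem fieldRep_mlieBracket (he : e ∈ atlas (Coord n) M)
    {A B : (q : M) → TangentSpace (𝓡 n) q} (hA : StatisticalManifold.IsSmoothField A)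
    (hB : StatisticalManifold.IsSmoothField B) {z : Coord n} (hz : z ∈ e.target) :
    fieldRep e (VectorField.mlieBracket (𝓡 n) A B) z =
      fderiv ℝ (fieldRep e B) z (fieldRep e A z) - fderiv ℝ (fieldRep e A) z (fieldRep e B z) := by
  have h3 : minSmoothness ℝ 3 ≤ (∞ : WithTop ℕ∞) := by
    rw [minSmoothness_of_isRCLikeNormedField]; exact WithTop.coe_le_coe.2 (le_top (a := (3 : ℕ∞)))
  have h2 : minSmoothness ℝ 2 ≤ (∞ : WithTop ℕ∞) := by
    rw [minSmoothness_of_isRCLikeNormedField]; exact WithTop.coe_le_coe.2 (le_top (a := (2 : ℕ∞)))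
  have : IsManifold (𝓡 n) (minSmoothness ℝ 3) M := IsManifold.of_le (n := ∞) h3
  have : IsManifold (𝓡 n) (minSmoothness ℝ 2) M := IsManifold.of_le (n := ∞) h2
  have h1 (V : (q : M) → TangentSpace (𝓡 n) q) :
      fieldRep e V =ᶠ[𝓝 z] VectorField.mpullback (𝓡 n) (𝓡 n) e.symm V := by
    filter_upwards [e.open_target.mem_nhds hz] with y hy using fieldRep_eq_mpullback he V hy
  rw [fieldRep_eq_mpullback he _ hz, VectorField.mpullback_mlieBracket (n := ∞)
    ((hA _).mdifferentiableAt (by simp)) ((hB _).mdifferentiableAt (by simp))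
    ((chart_symm_contMDiffOn he).contMDiffAt (e.open_target.mem_nhds hz)) h2]
  refine (mlieBracket_eq_fderiv _ _ z).trans ?_
  rw [← (h1 A).fderiv_eq, ← (h1 B).fderiv_eq, ← (h1 A).eq_of_nhds, ← (h1 B).eq_of_nhds]

/-- A local extension is cut off by a bump function equal to 1 at `q`. The Hausdorff property makes
the bump function smooth on all of `M`. -/
theorem exists_smoothField_eq [T2Space M] {q : M} (a : TangentSpace (𝓡 n) q) :
    ∃ A : (q : M) → TangentSpace (𝓡 n) q, StatisticalManifold.IsSmoothField A ∧ A q = a := by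
  obtain ⟨s, hs, hs'⟩ := FiberBundle.exists_contMDiffOn_extend (𝓡 n) (k := ∞) (Coord n) a
  obtain ⟨t, hts, ht, hqt⟩ := mem_nhds_iff.1 hs
  obtain ⟨f, hf⟩ := ((SmoothBumpFunction.nhds_basis_support (I := 𝓡 n)
    (ht.mem_nhds hqt)).ex_mem)
  refine ⟨(f : M → ℝ) • FiberBundle.extend (Coord n) a, ?_, ?_⟩
  · exact ContMDiffOn.smul_section_of_tsupport f.contMDiff.contMDiffOn ht hf (hs'.mono hts)
  · simp

end charts
end AlphaFrame

namespace AlphaFrame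

variable {n : ℕ} {M : Type*} [TopologicalSpace M] [ChartedSpace (Coord n) M]

theorem sum_rotate {ι κ ν : Type*} [Fintype ι] [Fintype κ] [Fintype ν] (f : ι → κ → ν → ℝ) :
    ∑ i, ∑ j, ∑ k, f i j k = ∑ j, ∑ k, ∑ i, f i j k := by
  rw [Finset.sum_comm]
  exact Finset.sum_congr rfl fun j _ => Finset.sum_comm

namespace StatisticalManifold

/-! ### Linearity of expectations, with integrability carried along. -/

section expectation

variable {X : Type*} [MeasurableSpace X] {μ : Measure X} {S : StatisticalManifold n M μ}

/-- The expectation of `f` at `q` exists and is equal to `v`. -/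
def HasExpect (S : StatisticalManifold n M μ) (q : M) (f : X → ℝ) (v : ℝ) : Prop :=
  Integrable (fun x => f x * S.p q x) μ ∧ expect μ S.p q f = v

theorem HasExpect.const_mul {q : M} {f : X → ℝ} {v : ℝ} (h : HasExpect S q f v) (c : ℝ) :
    HasExpect S q (fun x => c * f x) (c * v) := by
  refine ⟨by simpa only [mul_assoc] using h.1.const_mul c, ?_⟩
  rw [← h.2]
  simp only [expect, mul_assoc, integral_const_mul]

theorem HasExpect.add {q : M} {f g : X → ℝ} {v w : ℝ} (hf : HasExpect S q f v)
    (hg : HasExpect S q g w) : HasExpect S q (fun x => f x + g x) (v + w) := by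
  refine ⟨by simp only [add_mul]; exact hf.1.add hg.1, ?_⟩
  rw [← hf.2, ← hg.2]
  simp only [expect, add_mul]
  exact integral_add hf.1 hg.1

theorem HasExpect.sum {q : M} {ι : Type*} {s : Finset ι} {f : ι → X → ℝ} {v : ι → ℝ}
    (h : ∀ i ∈ s, HasExpect S q (f i) (v i)) :
    HasExpect S q (fun x => ∑ i ∈ s, f i x) (∑ i ∈ s, v i) := by
  refine ⟨by simpa only [Finset.sum_mul] using integrable_finsetSum s fun i hi => (h i hi).1, ?_⟩
  simp only [expect, Finset.sum_mul]
  rw [integral_finsetSum s fun i hi => (h i hi).1]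
  exact Finset.sum_congr rfl fun i hi => (h i hi).2

end expectation

/-! ### The log-likelihood and its derivatives in a chart. -/

section logLik

variable {X : Type*} [MeasurableSpace X] {μ : Measure X} (S : StatisticalManifold n M μ)

/-- The log-likelihood of the sample `x` in the chart `e`. -/
noncomputable def logLik (e : OpenPartialHomeomorph M (Coord n)) (x : X) (z : Coord n) : ℝ :=
  Real.log (S.p (e.symm z) x)

theorem fderiv_logLik_eq_sum (e : OpenPartialHomeomorph M (Coord n)) (x : X) (y a : Coord n) :
    fderiv ℝ (S.logLik e x) y a = ∑ i, a i * dl S.p e i y x :=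
  map_eq_sum _ a

variable [IsManifold (𝓡 n) ∞ M] {e : OpenPartialHomeomorph M (Coord n)}

theorem logLik_contDiffOn (he : e ∈ atlas (Coord n) M) (x : X) :
    ContDiffOn ℝ ∞ (S.logLik e x) e.target := by
  have h : ContMDiffOn (𝓡 n) 𝓘(ℝ, ℝ) ∞ (fun z => S.p (e.symm z) x) e.target :=
    (S.smooth x).comp_contMDiffOn (chart_symm_contMDiffOn he)
  exact h.contDiffOn.log fun z _ => (S.pos _ _).ne'

theorem logLik_differentiableAt (he : e ∈ atlas (Coord n) M) (x : X) {y : Coord n}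
    (hy : y ∈ e.target) : DifferentiableAt ℝ (S.logLik e x) y :=
  ((S.logLik_contDiffOn he x).differentiableOn (by simp)).differentiableAt
    (e.open_target.mem_nhds hy)

theorem fderiv_logLik_differentiableAt (he : e ∈ atlas (Coord n) M) (x : X) {y : Coord n}
    (hy : y ∈ e.target) : DifferentiableAt ℝ (fderiv ℝ (S.logLik e x)) y :=
  (((S.logLik_contDiffOn he x).fderiv_of_isOpen e.open_target (m := 1) (by
    exact WithTop.coe_le_coe.2 (le_top (a := (2 : ℕ∞))))).differentiableOn (by simp)).differentiableAt
    (e.open_target.mem_nhds hy)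

theorem score_eq (he : e ∈ atlas (Coord n) M) {q : M} (hq : q ∈ e.source)
    (A : TangentSpace (𝓡 n) q) (x : X) :
    score S.p q A x = fderiv ℝ (S.logLik e x) (e q) (chartDeriv e q A) :=
  mfderiv_eq_fderiv_comp_chart (f := fun q' => Real.log (S.p q' x)) he hq
    (S.logLik_differentiableAt he x (e.map_source hq)) A

theorem ddl_eq (he : e ∈ atlas (Coord n) M) (x : X) {y : Coord n} (hy : y ∈ e.target)
    (i j : Fin n) :
    ddl S.p e i j y x = fderiv ℝ (fderiv ℝ (S.logLik e x)) y (dirVec i) (dirVec j) := by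
  have h := ((S.fderiv_logLik_differentiableAt he x hy).hasFDerivAt.clm_apply
    (hasFDerivAt_const (dirVec j) y)).fderiv
  change fderiv ℝ (fun z => fderiv ℝ (S.logLik e x) z (dirVec j)) y (dirVec i) = _
  rw [h]
  simp

theorem fderiv_fderiv_logLik_eq_sum (he : e ∈ atlas (Coord n) M) (x : X) {y : Coord n}
    (hy : y ∈ e.target) (a b : Coord n) :
    fderiv ℝ (fderiv ℝ (S.logLik e x)) y a b = ∑ i, ∑ j, a i * b j * ddl S.p e i j y x := by
  rw [map_eq_sum (fderiv ℝ (fderiv ℝ (S.logLik e x)) y) a]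
  simp only [sum_apply, smul_apply]
  refine Finset.sum_congr rfl fun i _ => ?_
  rw [map_eq_sum (fderiv ℝ (fderiv ℝ (S.logLik e x)) y (dirVec i)) b, Finset.smul_sum]
  refine Finset.sum_congr rfl fun j _ => ?_
  rw [S.ddl_eq he x hy]
  simp [mul_assoc]

theorem ddl_symm (he : e ∈ atlas (Coord n) M) (x : X) {y : Coord n} (hy : y ∈ e.target)
    (i j : Fin n) : ddl S.p e i j y x = ddl S.p e j i y x := by
  rw [S.ddl_eq he x hy, S.ddl_eq he x hy]
  refine (ContDiffAt.isSymmSndFDerivAt (n := ∞)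
    ((S.logLik_contDiffOn he x).contDiffAt (e.open_target.mem_nhds hy)) ?_).eq _ _
  rw [minSmoothness_of_isRCLikeNormedField]
  exact WithTop.coe_le_coe.2 (le_top (a := (2 : ℕ∞)))

/-- Product rule for `z ↦ D l(z)(B(z))`: the derivative falls either on `D l` or on the field. -/
theorem score₂_eq (he : e ∈ atlas (Coord n) M) {q : M} (hq : q ∈ e.source)
    (A : (q : M) → TangentSpace (𝓡 n) q) {B : (q : M) → TangentSpace (𝓡 n) q}
    (hB : DifferentiableAt ℝ (fieldRep e B) (e q)) (x : X) :
    score₂ S.p A B q x =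
      fderiv ℝ (fderiv ℝ (S.logLik e x)) (e q) (chartDeriv e q (A q)) (chartDeriv e q (B q)) +
      fderiv ℝ (S.logLik e x) (e q) (fderiv ℝ (fieldRep e B) (e q) (chartDeriv e q (A q))) := by
  have hy := e.map_source hq
  have h1 : ((fun q' => score S.p q' (B q') x) ∘ e.symm) =ᶠ[𝓝 (e q)]
      fun z => fderiv ℝ (S.logLik e x) z (fieldRep e B z) := by
    filter_upwards [e.open_target.mem_nhds hy] with z hz
    have := S.score_eq he (e.map_target hz) (B (e.symm z)) x
    rw [e.right_inv hz] at this
    exact this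
  have h2 := ((S.fderiv_logLik_differentiableAt he x hy).hasFDerivAt.clm_apply
    hB.hasFDerivAt).congr_of_eventuallyEq h1
  have h3 := mfderiv_eq_fderiv_comp_chart he hq h2.differentiableAt (A q)
  refine h3.trans ?_
  rw [h2.fderiv, fieldRep_apply e B hq]
  exact add_comm (fderiv ℝ (S.logLik e x) (e q) _) _

end logLik

/-! ### The Fisher metric and the Christoffel symbols. -/

section metric

variable {X : Type*} [MeasurableSpace X] {μ : Measure X} (S : StatisticalManifold n M μ) (α : ℝ)

theorem connectionForm_apply (e : OpenPartialHomeomorph M (Coord n)) (y a b : Coord n)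
    (k : Fin n) :
    S.connectionForm α e y a b k = ∑ i, ∑ j, a i * b j * S.christoffel α e i j k y := by
  simp only [connectionForm, sum_apply,
    ContinuousLinearMap.smulRight_apply, smul_apply, WithLp.ofLp_sum,
    Finset.sum_apply, WithLp.ofLp_smul, Pi.smul_apply]
  refine Finset.sum_congr rfl fun i _ => ?_
  simp only [Matrix.ofLp_toEuclideanCLM, Matrix.mulVec, dotProduct, Matrix.of_apply, smul_eq_mul,
    Finset.mul_sum]
  refine Finset.sum_congr rfl fun j _ => ?_
  simp
  ring

/-- The structure gives integrability only for coordinate vectors; bilinearity extends it to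
arbitrary directions. -/
theorem hasExpect₂ {e : OpenPartialHomeomorph M (Coord n)} (he : e ∈ atlas (Coord n) M) {y : Coord n} (hy : y ∈ e.target)
    (a b : Coord n) :
    HasExpect S (e.symm y) (fun x => fderiv ℝ (S.logLik e x) y a * fderiv ℝ (S.logLik e x) y b)
      (∑ i, ∑ j, a i * b j * S.metricMatrix e y i j) := by
  have h : HasExpect S (e.symm y)
      (fun x => ∑ i, ∑ j, a i * b j * (dl S.p e i y x * dl S.p e j y x))
      (∑ i, ∑ j, a i * b j * S.metricMatrix e y i j) :=
    .sum fun i _ => .sum fun j _ =>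
      HasExpect.const_mul ⟨S.integrable₂ e he y hy i j, rfl⟩ _
  convert! h using 2 with x
  simp only [fderiv_logLik_eq_sum, Finset.sum_mul_sum]
  exact Finset.sum_congr rfl fun i _ => Finset.sum_congr rfl fun j _ => by ring

theorem hasExpect₃ {e : OpenPartialHomeomorph M (Coord n)} (he : e ∈ atlas (Coord n) M) {y : Coord n} (hy : y ∈ e.target)
    (a b c : Coord n) :
    HasExpect S (e.symm y) (fun x => fderiv ℝ (S.logLik e x) y a * fderiv ℝ (S.logLik e x) y b *
        fderiv ℝ (S.logLik e x) y c)
      (∑ i, ∑ j, ∑ k, a i * b j * c k *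
        expect μ S.p (e.symm y) fun x => dl S.p e i y x * dl S.p e j y x * dl S.p e k y x) := by
  have h : HasExpect S (e.symm y)
      (fun x => ∑ i, ∑ j, ∑ k, a i * b j * c k *
        (dl S.p e i y x * dl S.p e j y x * dl S.p e k y x))
      (∑ i, ∑ j, ∑ k, a i * b j * c k *
        expect μ S.p (e.symm y) fun x => dl S.p e i y x * dl S.p e j y x * dl S.p e k y x) :=
    .sum fun i _ => .sum fun j _ => .sum fun k _ =>
      HasExpect.const_mul ⟨S.integrable₃ e he y hy i j k, rfl⟩ _
  convert! h using 2 with x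
  simp only [fderiv_logLik_eq_sum]
  rw [Finset.sum_mul, Finset.sum_mul]
  refine Finset.sum_congr rfl fun i _ => ?_
  rw [mul_assoc, Finset.sum_mul, Finset.mul_sum]
  refine Finset.sum_congr rfl fun j _ => ?_
  rw [Finset.mul_sum, Finset.mul_sum]
  exact Finset.sum_congr rfl fun k _ => by ring

end metric

section metric

variable {X : Type*} [MeasurableSpace X] {μ : Measure X} (S : StatisticalManifold n M μ)
  [IsManifold (𝓡 n) ∞ M] {e : OpenPartialHomeomorph M (Coord n)}

theorem hasExpect₂₁ (he : e ∈ atlas (Coord n) M) {y : Coord n} (hy : y ∈ e.target)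
    (a b c : Coord n) :
    HasExpect S (e.symm y) (fun x => fderiv ℝ (fderiv ℝ (S.logLik e x)) y a b *
        fderiv ℝ (S.logLik e x) y c)
      (∑ i, ∑ j, ∑ k, a i * b j * c k *
        expect μ S.p (e.symm y) fun x => ddl S.p e i j y x * dl S.p e k y x) := by
  have h : HasExpect S (e.symm y)
      (fun x => ∑ i, ∑ j, ∑ k, a i * b j * c k *
        (ddl S.p e i j y x * dl S.p e k y x))
      (∑ i, ∑ j, ∑ k, a i * b j * c k *
        expect μ S.p (e.symm y) fun x => ddl S.p e i j y x * dl S.p e k y x) :=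
    .sum fun i _ => .sum fun j _ => .sum fun k _ =>
      HasExpect.const_mul ⟨S.integrable₂₁ e he y hy i j k, rfl⟩ _
  convert! h using 2 with x
  simp only [fderiv_logLik_eq_sum, S.fderiv_fderiv_logLik_eq_sum he x hy]
  rw [Finset.sum_mul]
  refine Finset.sum_congr rfl fun i _ => ?_
  rw [Finset.sum_mul]
  refine Finset.sum_congr rfl fun j _ => ?_
  rw [Finset.mul_sum]
  exact Finset.sum_congr rfl fun k _ => by ring

theorem fisher_eq_sum (he : e ∈ atlas (Coord n) M) {q : M} (hq : q ∈ e.source)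
    (A B : TangentSpace (𝓡 n) q) :
    S.fisher q A B = ∑ i, ∑ j, chartDeriv e q A i * chartDeriv e q B j *
      S.metricMatrix e (e q) i j := by
  have := (S.hasExpect₂ he (e.map_source hq) (chartDeriv e q A) (chartDeriv e q B)).2
  rw [e.left_inv hq] at this
  rw [← this, fisher]
  simp only [S.score_eq he hq]

theorem fisher_sub_left (q : M) (A B C : TangentSpace (𝓡 n) q) :
    S.fisher q (A - B) C = S.fisher q A C - S.fisher q B C := by
  simp only [S.fisher_eq_sum (chart_mem_atlas _ q) (mem_chart_source _ q), map_sub,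
    PiLp.sub_apply, sub_mul, Finset.sum_sub_distrib]

/-- Makes the choice in `raise` computable: two vectors representing the same functional have a
difference of zero Fisher norm. -/
theorem raise_eq {q : M} {ℓ : TangentSpace (𝓡 n) q → ℝ} {Z : TangentSpace (𝓡 n) q}
    (h : ∀ C, S.fisher q Z C = ℓ C) : S.raise q ℓ = Z := by
  have h' : ∀ C, S.fisher q (S.raise q ℓ) C = ℓ C :=
    Classical.epsilon_spec (p := fun Z => ∀ C, S.fisher q Z C = ℓ C) ⟨Z, h⟩
  by_contra hne
  have h0 := S.fisher_pos q _ (sub_ne_zero.2 hne)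
  change 0 < S.fisher q (S.raise q ℓ - Z) (S.raise q ℓ - Z) at h0
  rw [fisher_sub_left, h, h', sub_self] at h0
  exact h0.false

/-- A nonzero kernel vector of the matrix would be the coordinate vector of a nonzero tangent vector
of zero Fisher norm. -/
theorem isUnit_metricMatrix (he : e ∈ atlas (Coord n) M) {y : Coord n} (hy : y ∈ e.target) :
    IsUnit (S.metricMatrix e y) := by
  rw [← Matrix.vecMul_injective_iff_isUnit]
  have hq := e.map_target hy
  intro v w hvw
  by_contra hne
  obtain ⟨A, hA⟩ := (chartDeriv_bijective he hq).2 (WithLp.toLp 2 (v - w))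
  have hA0 : A ≠ 0 := by
    rintro rfl
    rw [map_zero] at hA
    have := congrArg (WithLp.ofLp) hA
    exact hne (sub_eq_zero.1 this.symm)
  have h0 := S.fisher_pos _ A hA0
  change 0 < S.fisher _ A A at h0
  rw [S.fisher_eq_sum he hq, hA, e.right_inv hy, Finset.sum_comm] at h0
  refine h0.ne' (Finset.sum_eq_zero fun j _ => ?_)
  have h1 := congrFun hvw j
  simp only [Matrix.vecMul, dotProduct] at h1
  have h2 : ∑ i, (v - w) i * S.metricMatrix e y i j = 0 := by
    simp only [Pi.sub_apply, sub_mul, Finset.sum_sub_distrib, h1, sub_self]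
  calc _ = (v - w) j * ∑ i, (v - w) i * S.metricMatrix e y i j := by
        rw [Finset.mul_sum]
        exact Finset.sum_congr rfl fun i _ => by simp only; ring
    _ = 0 := by rw [h2, mul_zero]

theorem isUnit_det_metricMatrix (he : e ∈ atlas (Coord n) M) {y : Coord n} (hy : y ∈ e.target) :
    IsUnit (S.metricMatrix e y).det :=
  (Matrix.isUnit_iff_isUnit_det _).1 (S.isUnit_metricMatrix he hy)

variable (α : ℝ)

theorem sum_christoffel_mul_metric (he : e ∈ atlas (Coord n) M) {y : Coord n}
    (hy : y ∈ e.target) (i j k : Fin n) :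
    ∑ s, S.christoffel α e i j s y * S.metricMatrix e y s k = S.christoffelLow α e i j k y := by
  have h := Matrix.nonsing_inv_mul _ (S.isUnit_det_metricMatrix he hy)
  have h' (s : Fin n) : ∑ t, (S.metricMatrix e y)⁻¹ s t * S.metricMatrix e y t k =
      if s = k then 1 else 0 := by
    rw [← Matrix.mul_apply, h, Matrix.one_apply]
  simp only [christoffel, Finset.sum_mul]
  rw [Finset.sum_comm]
  simp only [mul_assoc, ← Finset.mul_sum, h']
  simp

/-- Second derivatives of `l` commute and the cubic term is symmetric for every `α`. All the torsion
statements rest on this. -/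
theorem christoffel_symm (he : e ∈ atlas (Coord n) M) {y : Coord n} (hy : y ∈ e.target)
    (i j k : Fin n) : S.christoffel α e i j k y = S.christoffel α e j i k y := by
  refine Finset.sum_congr rfl fun s _ => ?_
  unfold christoffelLow
  congr 3
  · ext x; rw [S.ddl_symm he x hy]
  · congr 1; ext x; rw [mul_comm (dl S.p e i y x)]

theorem connectionForm_symm (he : e ∈ atlas (Coord n) M) {y : Coord n} (hy : y ∈ e.target)
    (a b : Coord n) : S.connectionForm α e y a b = S.connectionForm α e y b a := by
  ext k
  rw [connectionForm_apply, connectionForm_apply, Finset.sum_comm]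
  refine Finset.sum_congr rfl fun i _ => Finset.sum_congr rfl fun j _ => ?_
  rw [S.christoffel_symm α he hy]
  ring

/-- The vector determined by the metric and the defining functional of the `α`-connection, where
`f` plays the role of the second derivative of the log-likelihood. -/
theorem chartDeriv_raise (he : e ∈ atlas (Coord n) M) {q : M} (hq : q ∈ e.source)
    (A B : TangentSpace (𝓡 n) q) (d : Coord n) {f : X → ℝ}
    (hf : ∀ x, f x = fderiv ℝ (fderiv ℝ (S.logLik e x)) (e q) (chartDeriv e q A)
      (chartDeriv e q B) + fderiv ℝ (S.logLik e x) (e q) d) :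
    chartDeriv e q (S.raise q fun C =>
      expect μ S.p q (fun x => f x * score S.p q C x) + (1 - α) / 2 *
        expect μ S.p q (fun x => score S.p q A x * score S.p q B x * score S.p q C x)) =
      d + S.connectionForm α e (e q) (chartDeriv e q A) (chartDeriv e q B) := by
  have hy := e.map_source hq
  set a := chartDeriv e q A with ha
  set b := chartDeriv e q B with hb
  -- The candidate is the tangent vector with the required coordinates; by `raise_eq` it suffices
  -- that it represents the functional.
  obtain ⟨Z, hZ⟩ := (chartDeriv_bijective he hq).2 (d + S.connectionForm α e (e q) a b)
  rw [S.raise_eq (Z := Z) ?_, hZ]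
  intro C
  set c := chartDeriv e q C with hc
  have h1 := ((S.hasExpect₂₁ he hy a b c).add (S.hasExpect₂ he hy d c)).2
  have h2 := (S.hasExpect₃ he hy a b c).2
  rw [e.left_inv hq] at h1 h2
  have h3 : (fun x => f x * score S.p q C x) = fun x =>
      fderiv ℝ (fderiv ℝ (S.logLik e x)) (e q) a b * fderiv ℝ (S.logLik e x) (e q) c +
        fderiv ℝ (S.logLik e x) (e q) d * fderiv ℝ (S.logLik e x) (e q) c := by
    ext x
    rw [hf, S.score_eq he hq, add_mul]
  have h4 : (fun x => score S.p q A x * score S.p q B x * score S.p q C x) = fun x =>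
      fderiv ℝ (S.logLik e x) (e q) a * fderiv ℝ (S.logLik e x) (e q) b *
        fderiv ℝ (S.logLik e x) (e q) c := by
    ext x
    simp only [S.score_eq he hq, ha, hb, hc]
  rw [h3, h4, h1, h2, S.fisher_eq_sum he hq, hZ]
  simp only [PiLp.add_apply, add_mul, Finset.sum_add_distrib, connectionForm_apply]
  -- Pairing `ω(a)b` with `c` in the metric lowers the raised index of the Christoffel symbols.
  have h5 : ∑ s, ∑ k, (∑ i, ∑ j, a i * b j * S.christoffel α e i j s (e q)) * c k *
      S.metricMatrix e (e q) s k =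
      ∑ i, ∑ j, ∑ k, a i * b j * c k * S.christoffelLow α e i j k (e q) := by
    simp only [← S.sum_christoffel_mul_metric α he hy, Finset.mul_sum, Finset.sum_mul]
    rw [Finset.sum_comm]
    refine (Finset.sum_congr rfl fun k _ => sum_rotate _).trans ((sum_rotate _).trans ?_)
    exact Finset.sum_congr rfl fun i _ => Finset.sum_congr rfl fun j _ =>
      Finset.sum_congr rfl fun k _ => Finset.sum_congr rfl fun s _ => by ring
  rw [← hc, h5]
  simp only [christoffelLow, mul_add, Finset.sum_add_distrib, e.left_inv hq, Finset.mul_sum]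
  rw [add_comm, add_assoc, add_assoc]
  congr 1
  rw [add_comm]
  congr 1
  exact Finset.sum_congr rfl fun i _ => Finset.sum_congr rfl fun j _ =>
    Finset.sum_congr rfl fun k _ => by ring

end metric
end StatisticalManifold
set_option maxSynthPendingDepth 3

namespace StatisticalManifold

variable {X : Type*} [MeasurableSpace X] {μ : Measure X} (S : StatisticalManifold n M μ) (α : ℝ)

/-! ### The connection and its curvature on the base, in a chart. -/

section curvature

/-- The curvature `dω + ω ∧ ω` of the `α`-connection form in a chart. -/
noncomputable def chartCurvature (e : OpenPartialHomeomorph M (Coord n)) (y : Coord n) :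
    Coord n →L[ℝ] Coord n →L[ℝ] Gl n :=
  fderiv ℝ (S.connectionForm α e) y - (fderiv ℝ (S.connectionForm α e) y).flip +
    ((ContinuousLinearMap.compL ℝ (Coord n) (Coord n) (Coord n)).bilinearComp
        (S.connectionForm α e y) (S.connectionForm α e y) -
      ((ContinuousLinearMap.compL ℝ (Coord n) (Coord n) (Coord n)).bilinearComp
        (S.connectionForm α e y) (S.connectionForm α e y)).flip)

theorem chartCurvature_apply (e : OpenPartialHomeomorph M (Coord n)) (y v w : Coord n) :
    S.chartCurvature α e y v w = fderiv ℝ (S.connectionForm α e) y v w -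
      fderiv ℝ (S.connectionForm α e) y w v +
      (S.connectionForm α e y v ∘L S.connectionForm α e y w -
        S.connectionForm α e y w ∘L S.connectionForm α e y v) :=
  rfl

theorem connectionForm_dirVec (e : OpenPartialHomeomorph M (Coord n)) (y : Coord n)
    (i j k : Fin n) :
    S.connectionForm α e y (dirVec i) (dirVec j) k = S.christoffel α e i j k y := by
  rw [connectionForm_apply]
  simp

theorem metricMatrix_contDiffOn {e : OpenPartialHomeomorph M (Coord n)} (he : e ∈ atlas (Coord n) M) (i j : Fin n) :
    ContDiffOn ℝ ∞ (fun y => S.metricMatrix e y i j) e.target :=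
  S.smooth₂ e he i j

end curvature

variable [IsManifold (𝓡 n) ∞ M] {e : OpenPartialHomeomorph M (Coord n)}

theorem contDiffOn_det {ι : Type*} [Fintype ι] [DecidableEq ι] {E : Type*} [NormedAddCommGroup E]
    [NormedSpace ℝ E] {s : Set E} {g : E → Matrix ι ι ℝ}
    (h : ∀ i j, ContDiffOn ℝ ∞ (fun y => g y i j) s) :
    ContDiffOn ℝ ∞ (fun y => (g y).det) s := by
  simp only [Matrix.det_apply']
  exact ContDiffOn.sum fun σ _ => contDiffOn_const.mul (contDiffOn_prod fun i _ => h _ _)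

/-- Cramer's rule: adjugate over determinant, both polynomial in the entries. -/
theorem inv_metricMatrix_contDiffOn (he : e ∈ atlas (Coord n) M) (i j : Fin n) :
    ContDiffOn ℝ ∞ (fun y => (S.metricMatrix e y)⁻¹ i j) e.target := by
  have h1 : ContDiffOn ℝ ∞ (fun y => (S.metricMatrix e y).adjugate i j) e.target := by
    simp only [Matrix.adjugate_apply]
    refine contDiffOn_det fun k l => ?_
    simp only [Matrix.updateRow_apply]
    split_ifs
    · exact contDiffOn_const
    · exact S.metricMatrix_contDiffOn he k l
  have h2 := contDiffOn_det (S.metricMatrix_contDiffOn he)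
  have h3 := (h2.inv fun y hy => (S.isUnit_det_metricMatrix he hy).ne_zero).mul h1
  refine h3.congr fun y hy => ?_
  simp [Matrix.inv_def]

theorem christoffel_contDiffOn (he : e ∈ atlas (Coord n) M) (i j k : Fin n) :
    ContDiffOn ℝ ∞ (S.christoffel α e i j k) e.target :=
  ContDiffOn.sum fun s _ =>
    ((S.smooth₂₁ e he i j s).add (contDiffOn_const.mul (S.smooth₃ e he i j s))).mul
      (S.inv_metricMatrix_contDiffOn he s k)

theorem connectionForm_contDiffOn (he : e ∈ atlas (Coord n) M) :
    ContDiffOn ℝ ∞ (S.connectionForm α e) e.target := by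
  rw [contDiffOn_clm_apply]
  intro a
  rw [contDiffOn_clm_apply]
  intro b
  rw [contDiffOn_euclidean]
  intro k
  simp only [connectionForm_apply]
  exact ContDiffOn.sum fun i _ => ContDiffOn.sum fun j _ =>
    contDiffOn_const.mul (S.christoffel_contDiffOn α he i j k)

theorem connectionForm_differentiableAt (he : e ∈ atlas (Coord n) M) {y : Coord n}
    (hy : y ∈ e.target) : DifferentiableAt ℝ (S.connectionForm α e) y :=
  ((S.connectionForm_contDiffOn α he).differentiableOn (by simp)).differentiableAt
    (e.open_target.mem_nhds hy)

/-- Only the value of `A` at `q` matters, and `B` need only be differentiable in the chart. This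
allows iterated derivatives, brackets and merely local fields as arguments. -/
theorem chartDeriv_nabla (he : e ∈ atlas (Coord n) M) {q : M} (hq : q ∈ e.source)
    (A : (q : M) → TangentSpace (𝓡 n) q) {B : (q : M) → TangentSpace (𝓡 n) q}
    (hB : DifferentiableAt ℝ (fieldRep e B) (e q)) :
    chartDeriv e q (S.nabla α A B q) = fderiv ℝ (fieldRep e B) (e q) (chartDeriv e q (A q)) +
      S.connectionForm α e (e q) (chartDeriv e q (A q)) (chartDeriv e q (B q)) :=
  S.chartDeriv_raise α he hq (A q) (B q) _ fun x => S.score₂_eq he hq A hB x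

theorem fieldRep_nabla (he : e ∈ atlas (Coord n) M) {z : Coord n} (hz : z ∈ e.target)
    (A : (q : M) → TangentSpace (𝓡 n) q) {B : (q : M) → TangentSpace (𝓡 n) q}
    (hB : DifferentiableAt ℝ (fieldRep e B) z) :
    fieldRep e (S.nabla α A B) z = fderiv ℝ (fieldRep e B) z (fieldRep e A z) +
      S.connectionForm α e z (fieldRep e A z) (fieldRep e B z) := by
  have h := S.chartDeriv_nabla α he (e.map_target hz) A (B := B) (by rwa [e.right_inv hz])
  rw [e.right_inv hz] at h
  exact h

theorem comp_chart_contDiffAt (he : e ∈ atlas (Coord n) M) {γ : ℝ → M} {s : ℝ}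
    (hγ : ContMDiffAt 𝓘(ℝ, ℝ) (𝓡 n) ∞ γ s) (hs : γ s ∈ e.source) :
    ContDiffAt ℝ ∞ (e ∘ γ) s :=
  (ContMDiffAt.comp s ((chart_contMDiffOn he).contMDiffAt (e.open_source.mem_nhds hs))
    hγ).contDiffAt

theorem chartDeriv_velocity (he : e ∈ atlas (Coord n) M) {γ : ℝ → M} {s : ℝ}
    (hγ : ContMDiffAt 𝓘(ℝ, ℝ) (𝓡 n) ∞ γ s) (hs : γ s ∈ e.source) :
    chartDeriv e (γ s) (velocity (n := n) γ s) = deriv (e ∘ γ) s := by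
  have := mfderiv_comp (I := 𝓘(ℝ, ℝ)) (I' := 𝓡 n) (I'' := 𝓡 n) s
    ((chart_mdifferentiable he).mdifferentiableAt hs) (hγ.mdifferentiableAt (by simp))
  rw [mfderiv_eq_fderiv] at this
  rw [← fderiv_apply_one_eq_deriv]
  exact (DFunLike.congr_fun this (1 : ℝ)).symm

theorem hasDerivAt_deriv {E : Type*} [NormedAddCommGroup E] [NormedSpace ℝ E] {x : ℝ → E} {t : ℝ}
    (h : ContDiffAt ℝ ∞ x t) : HasDerivAt (deriv x) (deriv (deriv x) t) t := by
  have h1 : ContDiffAt ℝ 1 (fderiv ℝ x) t :=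
    h.fderiv_right (WithTop.coe_le_coe.2 (le_top (a := (2 : ℕ∞))))
  have h2 : DifferentiableAt ℝ (deriv x) t :=
    (h1.differentiableAt (by simp)).clm_apply (differentiableAt_const (1 : ℝ))
  exact h2.hasDerivAt

theorem chartDeriv_nablaVelocity (he : e ∈ atlas (Coord n) M) {γ : ℝ → M} {J : Set ℝ}
    (hJ : IsOpen J) (hγ : ContMDiffOn 𝓘(ℝ, ℝ) (𝓡 n) ∞ γ J) {t : ℝ} (ht : t ∈ J)
    (hγt : γ t ∈ e.source) :
    chartDeriv e (γ t) (S.nablaVelocity α γ t) = deriv (deriv (e ∘ γ)) t +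
      S.connectionForm α e (e (γ t)) (deriv (e ∘ γ) t) (deriv (e ∘ γ) t) := by
  have hγ' (s : ℝ) (hs : s ∈ J) := hγ.contMDiffAt (hJ.mem_nhds hs)
  have hc := comp_chart_contDiffAt he (hγ' t ht) hγt
  have hv := chartDeriv_velocity he (hγ' t ht) hγt
  -- The chain rule gives `d/dt (γ' l) = D²l(x', x') + Dl(x'')`, so the vector `d` of
  -- `chartDeriv_raise` is the coordinate acceleration.
  rw [nablaVelocity, S.chartDeriv_raise α he hγt (velocity (n := n) γ t)
    (velocity (n := n) γ t) (d := deriv (deriv (e ∘ γ)) t), hv]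
  intro x
  have h6 : (fun s => score (n := n) S.p (γ s) (velocity (n := n) γ s) x) =ᶠ[𝓝 t]
      fun s => fderiv ℝ (S.logLik e x) ((e ∘ γ) s) (deriv (e ∘ γ) s) := by
    filter_upwards [hJ.mem_nhds ht, (hγ.continuousOn.continuousAt
      (hJ.mem_nhds ht)).preimage_mem_nhds (e.open_source.mem_nhds hγt)] with s h1 h2
    rw [S.score_eq he h2, chartDeriv_velocity he (hγ' s h1) h2]
    rfl
  rw [h6.deriv_eq, hv]
  have h7 := (((S.fderiv_logLik_differentiableAt he x (e.map_source hγt)).hasFDerivAt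
    (x := (e ∘ γ) t)).comp_hasDerivAt t (hc.differentiableAt (by simp)).hasDerivAt).clm_apply
    (hasDerivAt_deriv hc)
  exact h7.deriv

theorem nablaVelocity_eq_zero_iff (he : e ∈ atlas (Coord n) M) {γ : ℝ → M} {J : Set ℝ}
    (hJ : IsOpen J) (hγ : ContMDiffOn 𝓘(ℝ, ℝ) (𝓡 n) ∞ γ J) {t : ℝ} (ht : t ∈ J)
    (hγt : γ t ∈ e.source) :
    S.nablaVelocity α γ t = 0 ↔ deriv (deriv (e ∘ γ)) t +
      S.connectionForm α e (e (γ t)) (deriv (e ∘ γ) t) (deriv (e ∘ γ) t) = 0 := by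
  rw [← S.chartDeriv_nablaVelocity α he hJ hγ ht hγt]
  exact (map_eq_zero_iff _ (chartDeriv_bijective he hγt).1).symm

/-- The `α`-connections are torsion free. -/
theorem torsionFree : S.TorsionFree α := by
  intro A B hA hB q
  have he := chart_mem_atlas (Coord n) q
  have hq := mem_chart_source (Coord n) q
  set e := chartAt (Coord n) q
  have hy := e.map_source hq
  have hd {V : (q : M) → TangentSpace (𝓡 n) q} (hV : IsSmoothField V) :
      DifferentiableAt ℝ (fieldRep e V) (e q) :=
    ((fieldRep_contDiffOn he hV).differentiableOn (by simp)).differentiableAt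
      (e.open_target.mem_nhds hy)
  apply (chartDeriv_bijective he hq).1
  have h := fieldRep_mlieBracket he hA hB hy
  rw [fieldRep_apply e _ hq, fieldRep_apply e _ hq, fieldRep_apply e _ hq] at h
  -- The derivatives of the fields cancel against the bracket; the antisymmetric part of `ω`
  -- remains.
  rw [map_sub, map_sub, S.chartDeriv_nabla α he hq A (hd hB), S.chartDeriv_nabla α he hq B (hd hA),
    h, S.connectionForm_symm α he hy, map_zero]
  abel

/-- In the commutator the second derivatives of `C` cancel by symmetry and its first derivatives
cancel against the bracket term, which leaves a tensorial expression. -/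
theorem chartDeriv_curvature (he : e ∈ atlas (Coord n) M) {q : M} (hq : q ∈ e.source)
    {A B C : (q : M) → TangentSpace (𝓡 n) q} (hA : IsSmoothField A) (hB : IsSmoothField B)
    (hC : IsSmoothField C) :
    chartDeriv e q (S.curvature α A B C q) = S.chartCurvature α e (e q) (chartDeriv e q (A q))
      (chartDeriv e q (B q)) (chartDeriv e q (C q)) := by
  have hy := e.map_source hq
  have hd {V : (q : M) → TangentSpace (𝓡 n) q} (hV : IsSmoothField V) {z : Coord n}
      (hz : z ∈ e.target) : DifferentiableAt ℝ (fieldRep e V) z :=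
    ((fieldRep_contDiffOn he hV).differentiableOn (by simp)).differentiableAt
      (e.open_target.mem_nhds hz)
  have hC2 : DifferentiableAt ℝ (fderiv ℝ (fieldRep e C)) (e q) :=
    (((fieldRep_contDiffOn he hC).fderiv_of_isOpen e.open_target (m := 1) (by
      exact WithTop.coe_le_coe.2 (le_top (a := (2 : ℕ∞))))).differentiableOn
      (by simp)).differentiableAt (e.open_target.mem_nhds hy)
  have hsymm : IsSymmSndFDerivAt ℝ (fieldRep e C) (e q) := by
    refine ContDiffAt.isSymmSndFDerivAt (n := ∞)
      ((fieldRep_contDiffOn he hC).contDiffAt (e.open_target.mem_nhds hy)) ?_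
    rw [minSmoothness_of_isRCLikeNormedField]
    exact WithTop.coe_le_coe.2 (le_top (a := (2 : ℕ∞)))
  -- The coordinate formula for `∇_V C` holds on a neighbourhood, so it can be differentiated once
  -- more.
  have key {V : (q : M) → TangentSpace (𝓡 n) q} (hV : IsSmoothField V) :=
    ((hC2.hasFDerivAt.clm_apply (hd hV hy).hasFDerivAt).add
      (((S.connectionForm_differentiableAt α he hy).hasFDerivAt.clm_apply
        (hd hV hy).hasFDerivAt).clm_apply (hd hC hy).hasFDerivAt)).congr_of_eventuallyEq
      (f₁ := fieldRep e (S.nabla α V C)) (by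
        filter_upwards [e.open_target.mem_nhds hy] with z hz
        exact S.fieldRep_nabla α he hz V (hd hC hz))
  have hbr := fieldRep_mlieBracket he hA hB hy
  rw [fieldRep_apply e _ hq] at hbr
  rw [curvature, map_sub, map_sub, S.chartDeriv_nabla α he hq _ (key hB).differentiableAt,
    S.chartDeriv_nabla α he hq _ (key hA).differentiableAt,
    S.chartDeriv_nabla α he hq _ (hd hC hy), S.chartDeriv_nabla α he hq _ (hd hC hy),
    S.chartDeriv_nabla α he hq _ (hd hC hy), (key hA).fderiv, (key hB).fderiv, hbr,
    chartCurvature_apply]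
  simp only [fieldRep_apply e _ hq]
  simp only [add_apply, sub_apply, ContinuousLinearMap.comp_apply,
    ContinuousLinearMap.flip_apply, map_add, map_sub]
  rw [hsymm.eq (chartDeriv e q (A q)) (chartDeriv e q (B q))]
  abel

/-- The arguments occur in the order `j, i` because the component is `⟨R(∂ⱼ, ∂ᵢ)∂ₖ, ∂ₗ⟩`;
contraction with the metric lowers `l`. -/
theorem curvatureComp_eq (he : e ∈ atlas (Coord n) M) {y : Coord n} (hy : y ∈ e.target)
    (i j k l : Fin n) :
    S.curvatureComp α e i j k l y =
      ∑ s, S.chartCurvature α e y (dirVec j) (dirVec i) (dirVec k) s * S.metricMatrix e y s l := by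
  have hΓ (i k s j : Fin n) : fderiv ℝ (S.christoffel α e i k s) y (dirVec j) =
      fderiv ℝ (S.connectionForm α e) y (dirVec j) (dirVec i) (dirVec k) s := by
    have h1 : S.christoffel α e i k s = fun z =>
        (EuclideanSpace.proj s : Coord n →L[ℝ] ℝ)
          (S.connectionForm α e z (dirVec i) (dirVec k)) := by
      ext z
      exact (S.connectionForm_dirVec α e z i k s).symm
    have h2 := (EuclideanSpace.proj s : Coord n →L[ℝ] ℝ).hasFDerivAt.comp y
      (((S.connectionForm_differentiableAt α he hy).hasFDerivAt.clm_apply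
        (hasFDerivAt_const (dirVec i) y)).clm_apply (hasFDerivAt_const (dirVec k) y))
    rw [h1]
    refine (DFunLike.congr_fun h2.fderiv (dirVec j)).trans ?_
    simp
  have hQ (i j k s : Fin n) : (S.connectionForm α e y (dirVec j))
      (S.connectionForm α e y (dirVec i) (dirVec k)) s =
      ∑ t, S.christoffel α e j t s y * S.christoffel α e i k t y := by
    rw [connectionForm_apply]
    simp [connectionForm_dirVec, mul_comm]
  simp only [curvatureComp, chartCurvature_apply, hΓ, add_apply, sub_apply,
    ContinuousLinearMap.comp_apply, PiLp.add_apply, PiLp.sub_apply, hQ, add_mul,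
    Finset.sum_add_distrib, ← S.sum_christoffel_mul_metric α he hy]
  congr 1
  simp only [sub_mul, Finset.sum_sub_distrib, Finset.sum_mul]
  congr 1
  · rw [Finset.sum_comm]
    exact Finset.sum_congr rfl fun s _ => Finset.sum_congr rfl fun t _ => by ring
  · rw [Finset.sum_comm]
    exact Finset.sum_congr rfl fun s _ => Finset.sum_congr rfl fun t _ => by ring

/-- Lowering an index by an invertible matrix loses nothing, and a trilinear map is determined on
basis vectors. -/
theorem flat_iff : S.Flat α ↔
    ∀ e ∈ atlas (Coord n) M, ∀ y ∈ e.target, S.chartCurvature α e y = 0 := by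
  refine forall₂_congr fun e he => forall₂_congr fun y hy => ?_
  simp only [S.curvatureComp_eq α he hy]
  refine ⟨fun h => ?_, fun h i j k l => by simp [h]⟩
  have h1 (i j k : Fin n) :
      S.chartCurvature α e y (dirVec j) (dirVec i) (dirVec k) = 0 := by
    have h2 : Matrix.vecMul (S.chartCurvature α e y (dirVec j) (dirVec i) (dirVec k)).ofLp
        (S.metricMatrix e y) = Matrix.vecMul 0 (S.metricMatrix e y) := by
      rw [Matrix.zero_vecMul]
      exact funext fun l => h i j k l
    have h3 := (Matrix.vecMul_injective_iff_isUnit.2 (S.isUnit_metricMatrix he hy)) h2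
    ext s
    exact congrFun h3 s
  ext1 v
  ext1 w
  ext1 u
  rw [map_eq_sum (S.chartCurvature α e y) v, sum_apply, sum_apply]
  refine Finset.sum_eq_zero fun j _ => ?_
  rw [smul_apply, map_eq_sum (S.chartCurvature α e y (dirVec j)) w, smul_apply, sum_apply]
  refine smul_eq_zero_of_right _ (Finset.sum_eq_zero fun i _ => ?_)
  rw [smul_apply, map_eq_sum (S.chartCurvature α e y (dirVec j) (dirVec i)) u]
  refine smul_eq_zero_of_right _ (Finset.sum_eq_zero fun k _ => ?_)
  rw [h1, smul_zero]

/-- Vanishing in one preferred chart per point passes to all charts through the vector-field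
condition, which mentions no chart. -/
theorem flat_tfae [T2Space M] : List.TFAE [S.Flat α,
    ∀ A B C : (q : M) → TangentSpace (𝓡 n) q,
      IsSmoothField A → IsSmoothField B → IsSmoothField C → ∀ q, S.curvature α A B C q = 0,
    ∀ q : M, S.chartCurvature α (chartAt (Coord n) q) (chartAt (Coord n) q q) = 0] := by
  rw [flat_iff]
  tfae_have 1 → 3 := fun h q =>
    h _ (chart_mem_atlas _ q) _ ((chartAt (Coord n) q).map_source (mem_chart_source _ q))
  tfae_have 3 → 2 := fun h A B C hA hB hC q => by
    have he := chart_mem_atlas (Coord n) q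
    have hq := mem_chart_source (Coord n) q
    apply (chartDeriv_bijective he hq).1
    rw [S.chartDeriv_curvature α he hq hA hB hC, h, map_zero]
    simp
  tfae_have 2 → 1 := fun h e he y hy => by
    have hq := e.map_target hy
    ext1 v
    ext1 w
    ext1 u
    obtain ⟨a, rfl⟩ := (chartDeriv_bijective he hq).2 v
    obtain ⟨b, rfl⟩ := (chartDeriv_bijective he hq).2 w
    obtain ⟨c, rfl⟩ := (chartDeriv_bijective he hq).2 u
    obtain ⟨A, hA, rfl⟩ := exists_smoothField_eq a
    obtain ⟨B, hB, rfl⟩ := exists_smoothField_eq b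
    obtain ⟨C, hC, rfl⟩ := exists_smoothField_eq c
    have := S.chartDeriv_curvature α he hq hA hB hC
    rw [h A B C hA hB hC, map_zero, e.right_inv hy] at this
    exact this.symm
  tfae_finish

end StatisticalManifold
-- Changes of charts.
section transition

variable [IsManifold (𝓡 n) ∞ M] {e e' : OpenPartialHomeomorph M (Coord n)}

theorem transition_contDiffAt (he : e ∈ atlas (Coord n) M) (he' : e' ∈ atlas (Coord n) M) {q : M}
    (hq : q ∈ e.source) (hq' : q ∈ e'.source) : ContDiffAt ℝ ∞ (e' ∘ e.symm) (e q) := by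
  have h1 := (chart_symm_contMDiffOn he).contMDiffAt (e.open_target.mem_nhds (e.map_source hq))
  have h2 := (chart_contMDiffOn he').contMDiffAt (x := e.symm (e q))
    (e'.open_source.mem_nhds (by rwa [e.left_inv hq]))
  exact (ContMDiffAt.comp (e q) h2 h1).contDiffAt

theorem chartDeriv_transition (he : e ∈ atlas (Coord n) M) (he' : e' ∈ atlas (Coord n) M) {q : M}
    (hq : q ∈ e.source) (hq' : q ∈ e'.source) (A : TangentSpace (𝓡 n) q) :
    chartDeriv e' q A = fderiv ℝ (e' ∘ e.symm) (e q) (chartDeriv e q A) :=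
  mfderiv_eq_fderiv_comp_chart he hq
    ((transition_contDiffAt he he' hq hq').differentiableAt (by simp)) A

theorem chartDeriv_isInvertible (he : e ∈ atlas (Coord n) M) {q : M} (hq : q ∈ e.source) :
    (chartDeriv e q).IsInvertible :=
  ⟨(chart_mdifferentiable he).mfderiv hq, rfl⟩

theorem fderiv_transition_differentiableAt (he : e ∈ atlas (Coord n) M)
    (he' : e' ∈ atlas (Coord n) M) {q : M} (hq : q ∈ e.source) (hq' : q ∈ e'.source) :
    DifferentiableAt ℝ (fderiv ℝ (e' ∘ e.symm)) (e q) :=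
  ((transition_contDiffAt he he' hq hq').fderiv_right (m := 1)
    (WithTop.coe_le_coe.2 (le_top (a := (2 : ℕ∞))))).differentiableAt (by simp)

end transition

namespace StatisticalManifold

variable {X : Type*} [MeasurableSpace X] {μ : Measure X} (S : StatisticalManifold n M μ) (α : ℝ)
  [IsManifold (𝓡 n) ∞ M] {e e' : OpenPartialHomeomorph M (Coord n)}

/-- The transformation law of the connection form under a change of charts. -/
theorem connectionForm_transition (he : e ∈ atlas (Coord n) M) (he' : e' ∈ atlas (Coord n) M)
    {q : M} (hq : q ∈ e.source) (hq' : q ∈ e'.source) (v w : Coord n) :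
    fderiv ℝ (e' ∘ e.symm) (e q) (S.connectionForm α e (e q) v w) =
      fderiv ℝ (fderiv ℝ (e' ∘ e.symm)) (e q) v w +
      S.connectionForm α e' (e' q) (fderiv ℝ (e' ∘ e.symm) (e q) v)
        (fderiv ℝ (e' ∘ e.symm) (e q) w) := by
  obtain ⟨a, rfl⟩ := (chartDeriv_bijective he hq).2 v
  -- `B` has constant coordinates `w` in `e`. Computing the same vector `∇_A B` at `q` in both
  -- charts gives the law; the second derivative of the transition map arises because `B` is not
  -- constant in `e'`.
  let B : (q : M) → TangentSpace (𝓡 n) q := fun r => (chartDeriv e r).inverse w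
  let A : (q : M) → TangentSpace (𝓡 n) q := fun r => (chartDeriv e r).inverse (chartDeriv e q a)
  have hAq : A q = a := (chartDeriv_isInvertible he hq).inverse_apply_self a
  have hB (r : M) (hr : r ∈ e.source) : chartDeriv e r (B r) = w :=
    (chartDeriv_isInvertible he hr).self_apply_inverse w
  have h1 : fieldRep e B =ᶠ[𝓝 (e q)] fun _ => w := by
    filter_upwards [e.open_target.mem_nhds (e.map_source hq)] with z hz
    exact hB _ (e.map_target hz)
  have h2 : fieldRep e' B =ᶠ[𝓝 (e' q)]
      fun z => fderiv ℝ (e' ∘ e.symm) ((e ∘ e'.symm) z) w := by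
    have hqe : e'.symm (e' q) ∈ e.source := by rwa [e'.left_inv hq']
    filter_upwards [e'.open_target.mem_nhds (e'.map_source hq'),
      (e'.continuousAt_symm (e'.map_source hq')).preimage_mem_nhds
        (e.open_source.mem_nhds hqe)] with z hz hz'
    change chartDeriv e' (e'.symm z) (B (e'.symm z)) = _
    rw [chartDeriv_transition he he' hz' (e'.map_target hz), hB _ hz']
    rfl
  have hτ : (e ∘ e'.symm) (e' q) = e q := by simp [e'.left_inv hq']
  have hd := fderiv_transition_differentiableAt he he' hq hq'
  rw [← hτ] at hd
  have h3 := ((hd.hasFDerivAt.comp (e' q) ((transition_contDiffAt he' he hq' hq).differentiableAt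
    (by simp)).hasFDerivAt).clm_apply (hasFDerivAt_const w (e' q))).congr_of_eventuallyEq h2
  have h4 := S.chartDeriv_nabla α he hq A
    (h1.differentiableAt_iff.2 (differentiableAt_const w))
  have h5 := S.chartDeriv_nabla α he' hq' A h3.differentiableAt
  rw [chartDeriv_transition he he' hq hq', h4, h1.fderiv_eq, h3.fderiv, hAq, hB q hq,
    chartDeriv_transition he he' hq hq', chartDeriv_transition he he' hq hq', hB q hq] at h5
  have h6 := chartDeriv_transition he' he hq' hq a
  rw [chartDeriv_transition he he' hq hq'] at h6
  simp only [fderiv_const_apply, zero_apply, zero_add, hτ, add_apply,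
    ContinuousLinearMap.comp_apply, ContinuousLinearMap.flip_apply, map_zero, ← h6] at h5
  simpa using h5

end StatisticalManifold

/-! ### The frame bundle in the charts lifted from the base. -/

namespace FrameBundle

theorem matrixIn_apply (e : OpenPartialHomeomorph M (Coord n)) (u : FrameBundle n M)
    (ξ : Coord n) : matrixIn e u ξ = chartDeriv e u.base (u.frame ξ) :=
  rfl

variable [IsManifold (𝓡 n) ∞ M]

/-- The lift of a chart of `M` to the frame bundle, as an open partial homeomorphism. -/
noncomputable def frameChart (e : OpenPartialHomeomorph M (Coord n)) (he : e ∈ atlas (Coord n) M) :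
    OpenPartialHomeomorph (FrameBundle n M) (Coord n × Gl n) :=
  (core n M).openPartialHomeomorph (liftChart e he) ⟨e, he, rfl⟩

variable {e e' : OpenPartialHomeomorph M (Coord n)}

theorem frameChart_mem_atlas (he : e ∈ atlas (Coord n) M) :
    frameChart e he ∈ atlas (Coord n × Gl n) (FrameBundle n M) := by
  change frameChart e he ∈ ⋃ (φ : PartialEquiv (FrameBundle n M) (Coord n × Gl n))
    (hφ : φ ∈ (core n M).atlas), {(core n M).openPartialHomeomorph φ hφ}
  simp only [mem_iUnion, mem_singleton_iff]
  exact ⟨liftChart e he, ⟨e, he, rfl⟩, rfl⟩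

theorem frameChart_apply (he : e ∈ atlas (Coord n) M) (u : FrameBundle n M) :
    frameChart e he u = (e u.base, matrixIn e u) :=
  rfl

theorem mem_frameChart_source (he : e ∈ atlas (Coord n) M) (u : FrameBundle n M) :
    u ∈ (frameChart e he).source ↔ u.base ∈ e.source :=
  Iff.rfl

theorem chartAt_eq_frameChart (u : FrameBundle n M) :
    chartAt (Coord n × Gl n) u = frameChart (chartAt (Coord n) u.base) (chart_mem_atlas _ _) :=
  rfl

theorem frameChart_mdifferentiable (he : e ∈ atlas (Coord n) M) :
    (frameChart e he).MDifferentiable 𝓘(ℝ, Coord n × Gl n) 𝓘(ℝ, Coord n × Gl n) := by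
  have : IsManifold 𝓘(ℝ, Coord n × Gl n) 1 (FrameBundle n M) :=
    IsManifold.of_le (n := ∞) (by norm_num)
  exact mdifferentiable_of_mem_atlas (frameChart_mem_atlas he)

/-- The differential of the chart `frameChart e` of the frame bundle. -/
noncomputable def frameDeriv (e : OpenPartialHomeomorph M (Coord n)) (he : e ∈ atlas (Coord n) M)
    (u : FrameBundle n M) : Tan u →L[ℝ] Coord n × Gl n :=
  mfderiv 𝓘(ℝ, Coord n × Gl n) 𝓘(ℝ, Coord n × Gl n) (frameChart e he) u

theorem frameDeriv_bijective (he : e ∈ atlas (Coord n) M) {u : FrameBundle n M}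
    (hu : u.base ∈ e.source) : Function.Bijective (frameDeriv e he u) :=
  (frameChart_mdifferentiable he).mfderiv_bijective hu

theorem frameDeriv_mfderiv_symm (he : e ∈ atlas (Coord n) M) {z : Coord n × Gl n}
    (hz : z ∈ (frameChart e he).target) (a : Coord n × Gl n) :
    frameDeriv e he ((frameChart e he).symm z)
      (mfderiv 𝓘(ℝ, Coord n × Gl n) 𝓘(ℝ, Coord n × Gl n) (frameChart e he).symm z a) = a :=
  DFunLike.congr_fun ((frameChart_mdifferentiable he).comp_symm_deriv hz) a

theorem chartDeriv_projDiff (he : e ∈ atlas (Coord n) M) {u : FrameBundle n M}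
    (hu : u.base ∈ e.source) (Y : Tan u) :
    chartDeriv e u.base (projDiff u Y) = (frameDeriv e he u Y).1 := by
  have h1 : FrameBundle.base (n := n) (M := M) =ᶠ[𝓝 u]
      fun v => e.symm ((frameChart e he v).1) := by
    filter_upwards [(frameChart e he).open_source.mem_nhds
      ((mem_frameChart_source he u).2 hu)] with v hv
    exact (e.left_inv ((mem_frameChart_source he v).1 hv)).symm
  have hΦ := ((frameChart_mdifferentiable he).mdifferentiableAt
    ((mem_frameChart_source he u).2 hu)).hasMFDerivAt
  have h2 : HasMFDerivAt 𝓘(ℝ, Coord n × Gl n) (𝓡 n) (fun v => (frameChart e he v).1) u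
      ((ContinuousLinearMap.fst ℝ (Coord n) (Gl n)).comp (frameDeriv e he u)) :=
    HasMFDerivAt.comp u (hasFDerivAt_fst (p := frameChart e he u)).hasMFDerivAt hΦ
  have h3 := HasMFDerivAt.comp u ((chart_mdifferentiable he).mdifferentiableAt_symm
    (e.map_source hu)).hasMFDerivAt h2
  have h4 := h3.congr_of_eventuallyEq h1
  have h5 := (chart_mdifferentiable he).comp_symm_deriv (e.map_source hu)
  rw [projDiff, h4.mfderiv]
  have h6 := DFunLike.congr_fun h5 (frameDeriv e he u Y).1
  rw [e.left_inv hu] at h6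
  exact h6

theorem mfderiv_matrixIn (he : e ∈ atlas (Coord n) M) {u : FrameBundle n M}
    (hu : u.base ∈ e.source) (Y : Tan u) :
    mfderiv 𝓘(ℝ, Coord n × Gl n) 𝓘(ℝ, Gl n) (matrixIn (n := n) (M := M) e) u Y =
      (frameDeriv e he u Y).2 := by
  have hΦ := ((frameChart_mdifferentiable he).mdifferentiableAt
    ((mem_frameChart_source he u).2 hu)).hasMFDerivAt
  have h2 : HasMFDerivAt 𝓘(ℝ, Coord n × Gl n) 𝓘(ℝ, Gl n) (fun v => (frameChart e he v).2) u
      ((ContinuousLinearMap.snd ℝ (Coord n) (Gl n)).comp (frameDeriv e he u)) :=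
    HasMFDerivAt.comp u (hasFDerivAt_snd (p := frameChart e he u)).hasMFDerivAt hΦ
  exact DFunLike.congr_fun h2.mfderiv Y

theorem canonicalForm_eq (he : e ∈ atlas (Coord n) M) {u : FrameBundle n M}
    (hu : u.base ∈ e.source) (Y : Tan u) :
    canonicalForm u Y = (matrixIn e u).inverse (frameDeriv e he u Y).1 := by
  refine ((matrixIn_isInvertible he hu).inverse_apply_eq.2 ?_).symm
  rw [matrixIn_apply, ← chartDeriv_projDiff he hu]
  exact congrArg _ (u.frame.apply_symm_apply _).symm

theorem matrixIn_transition (he : e ∈ atlas (Coord n) M) (he' : e' ∈ atlas (Coord n) M)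
    {u : FrameBundle n M} (hu : u.base ∈ e.source) (hu' : u.base ∈ e'.source) :
    matrixIn e' u = fderiv ℝ (e' ∘ e.symm) (e u.base) ∘L matrixIn e u := by
  ext1 ξ
  rw [matrixIn_apply, chartDeriv_transition he he' hu hu']
  rfl

/-- With `τ` the transition map, this differentiates `x' = τ(x)` and `A' = Dτ(x) A`. -/
theorem frameDeriv_transition (he : e ∈ atlas (Coord n) M) (he' : e' ∈ atlas (Coord n) M)
    {u : FrameBundle n M} (hu : u.base ∈ e.source) (hu' : u.base ∈ e'.source) (Y : Tan u) :
    frameDeriv e' he' u Y = (fderiv ℝ (e' ∘ e.symm) (e u.base) (frameDeriv e he u Y).1,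
      fderiv ℝ (fderiv ℝ (e' ∘ e.symm)) (e u.base) (frameDeriv e he u Y).1 ∘L matrixIn e u +
      fderiv ℝ (e' ∘ e.symm) (e u.base) ∘L (frameDeriv e he u Y).2) := by
  refine Prod.ext ?_ ?_
  · rw [← chartDeriv_projDiff he' hu', chartDeriv_transition he he' hu hu',
      chartDeriv_projDiff he hu]
  · rw [← mfderiv_matrixIn he' hu']
    have h1 : matrixIn (n := n) (M := M) e' =ᶠ[𝓝 u]
        (fun z : Coord n × Gl n => fderiv ℝ (e' ∘ e.symm) z.1 ∘L z.2) ∘ frameChart e he := by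
      filter_upwards [(frameChart e he).open_source.mem_nhds
        ((mem_frameChart_source he u).2 hu), (frameChart e' he').open_source.mem_nhds
        ((mem_frameChart_source he' u).2 hu')] with v hv hv'
      exact matrixIn_transition he he' hv hv'
    have hd : HasFDerivAt (fun z : Coord n × Gl n => fderiv ℝ (e' ∘ e.symm) z.1)
        (fderiv ℝ (fderiv ℝ (e' ∘ e.symm)) (e u.base) ∘L ContinuousLinearMap.fst ℝ _ _)
        (frameChart e he u) :=
      HasFDerivAt.comp (g := fderiv ℝ (e' ∘ e.symm)) (f := Prod.fst) (frameChart e he u)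
        (fderiv_transition_differentiableAt he he' hu hu').hasFDerivAt hasFDerivAt_fst
    have h2 := hd.clm_comp (hasFDerivAt_snd (p := frameChart e he u))
    have h3 := (HasMFDerivAt.comp u h2.hasMFDerivAt
      ((frameChart_mdifferentiable he).mdifferentiableAt
      ((mem_frameChart_source he u).2 hu)).hasMFDerivAt).congr_of_eventuallyEq h1
    refine (DFunLike.congr_fun h3.mfderiv Y).trans ?_
    exact add_comm _ _

end FrameBundle
-- Derivatives on the general linear group and of one-forms.
theorem hasFDerivAt_inverse {A : Gl n} (hA : A.IsInvertible) :
    ∃ D : Gl n →L[ℝ] Gl n, HasFDerivAt (ContinuousLinearMap.inverse : Gl n → Gl n) D A ∧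
      ∀ B, D B = -(A.inverse ∘L B ∘L A.inverse) := by
  obtain ⟨U, rfl⟩ : IsUnit A := by
    obtain ⟨f, rfl⟩ := hA
    exact (ContinuousLinearEquiv.unitsEquiv ℝ (Coord n)).symm f |>.isUnit
  have h := hasFDerivAt_ringInverse (𝕜 := ℝ) U
  rw [ContinuousLinearMap.ringInverse_eq_inverse] at h
  refine ⟨_, h, fun B => ?_⟩
  have hU' : ((U⁻¹ : (Gl n)ˣ) : Gl n) = (U : Gl n).inverse := by
    rw [← ContinuousLinearMap.ringInverse_eq_inverse, Ring.inverse_unit]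
  simp [hU', ContinuousLinearMap.mul_def, ContinuousLinearMap.comp_assoc]

/-- The derivative of `(x, A) ↦ A⁻¹ (σ_x(a₁) A + a₂)` at a point where this form vanishes. -/
theorem hasFDerivAt_inverse_comp {σ : Coord n → Coord n →L[ℝ] Gl n} {z : Coord n × Gl n}
    (hσ : DifferentiableAt ℝ σ z.1) (hz : z.2.IsInvertible) (a : Coord n × Gl n) :
    ∃ D : Coord n × Gl n →L[ℝ] Gl n,
      HasFDerivAt (fun y : Coord n × Gl n => y.2.inverse ∘L (σ y.1 a.1 ∘L y.2 + a.2)) D z ∧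
      (a.2 = -(σ z.1 a.1 ∘L z.2) → ∀ b, D b = z.2.inverse ∘L
        (fderiv ℝ σ z.1 b.1 a.1 ∘L z.2 + σ z.1 a.1 ∘L b.2)) := by
  obtain ⟨D, hD, hD'⟩ := hasFDerivAt_inverse hz
  have h1 : HasFDerivAt (fun z : Coord n × Gl n => z.2.inverse)
      (D ∘L ContinuousLinearMap.snd ℝ (Coord n) (Gl n)) z :=
    HasFDerivAt.comp (g := ContinuousLinearMap.inverse) (f := Prod.snd) z hD hasFDerivAt_snd
  have h2 : HasFDerivAt (fun z : Coord n × Gl n => σ z.1)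
      (fderiv ℝ σ z.1 ∘L ContinuousLinearMap.fst ℝ (Coord n) (Gl n)) z :=
    HasFDerivAt.comp (g := σ) (f := Prod.fst) z hσ.hasFDerivAt hasFDerivAt_fst
  have h3 := h1.clm_comp (((h2.clm_apply (hasFDerivAt_const a.1 z)).clm_comp
    (hasFDerivAt_snd (p := z))).add_const a.2)
  refine ⟨_, h3, fun ha b => ?_⟩
  -- The second factor vanishes here, so differentiating `A⁻¹` contributes nothing.
  rw [ha, add_neg_cancel]
  ext1 ξ
  simp [add_comm]

/-- The cancellation behind gluing: `J` is the derivative of a change of charts, and `(J A)⁻¹ J P =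
A⁻¹ P`. -/
theorem inverse_comp_eq_of_comp_eq {A J P Q : Gl n} (hA : A.IsInvertible)
    (hJA : (J ∘L A).IsInvertible) (h : Q = J ∘L P) : (J ∘L A).inverse ∘L Q = A.inverse ∘L P := by
  ext1 ξ
  refine hJA.inverse_apply_eq.2 ?_
  subst h
  simp only [ContinuousLinearMap.comp_apply, hA.self_apply_inverse]
  rfl

section exteriorDerivative

variable {V : Type*} [NormedAddCommGroup V] [NormedSpace ℝ V] {F : Type*} [NormedAddCommGroup F]
  [NormedSpace ℝ F] {P : Type*} [TopologicalSpace P] [ChartedSpace V P]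

/-- Only the germs at `u` of the components on chart-constant vectors enter, so they may be replaced
by explicit formulas `g` valid nearby. -/
theorem dOneForm_eq {η : (u : P) → TangentSpace 𝓘(ℝ, V) u →L[ℝ] F} {u : P} {g : V → V → F}
    (hg : ∀ a, ∀ᶠ y in 𝓝 (chartAt V u u),
      η ((chartAt V u).symm y) (mfderiv 𝓘(ℝ, V) 𝓘(ℝ, V) (chartAt V u).symm y a) = g a y)
    {D : V → V →L[ℝ] F} (hD : ∀ a, HasFDerivAt (g a) (D a) (chartAt V u u))
    (v w : TangentSpace 𝓘(ℝ, V) u) :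
    dOneForm η u v w =
      D (mfderiv 𝓘(ℝ, V) 𝓘(ℝ, V) (chartAt V u) u w) (mfderiv 𝓘(ℝ, V) 𝓘(ℝ, V) (chartAt V u) u v) -
      D (mfderiv 𝓘(ℝ, V) 𝓘(ℝ, V) (chartAt V u) u v)
        (mfderiv 𝓘(ℝ, V) 𝓘(ℝ, V) (chartAt V u) u w) := by
  have h (a : V) : fderiv ℝ (fun y => η ((chartAt V u).symm y)
      (mfderiv 𝓘(ℝ, V) 𝓘(ℝ, V) (chartAt V u).symm y a)) (chartAt V u u) = D a :=
    ((hD a).congr_of_eventuallyEq (hg a)).fderiv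
  exact congrArg₂ (· - ·)
    (DFunLike.congr_fun (h (mfderiv 𝓘(ℝ, V) 𝓘(ℝ, V) (chartAt V u) u w)) _)
    (DFunLike.congr_fun (h (mfderiv 𝓘(ℝ, V) 𝓘(ℝ, V) (chartAt V u) u v)) _)

end exteriorDerivative

/-! ### The connection, torsion and curvature forms on the frame bundle. -/

namespace StatisticalManifold

open FrameBundle

variable [IsManifold (𝓡 n) ∞ M] {X : Type*} [MeasurableSpace X] {μ : Measure X}
  (S : StatisticalManifold n M μ) (α : ℝ) {e e' : OpenPartialHomeomorph M (Coord n)}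

theorem frameFormIn_eq (he : e ∈ atlas (Coord n) M) {u : FrameBundle n M}
    (hu : u.base ∈ e.source) (Y : Tan u) :
    S.frameFormIn α e u Y = (matrixIn e u).inverse ∘L
      (S.connectionForm α e (e u.base) (frameDeriv e he u Y).1 ∘L matrixIn e u +
        (frameDeriv e he u Y).2) := by
  rw [← chartDeriv_projDiff he hu, ← mfderiv_matrixIn he hu]
  rfl

/-- The local forms of the connection on the frame bundle agree on overlaps. -/
theorem frameFormIn_eq_frameFormIn (he : e ∈ atlas (Coord n) M) (he' : e' ∈ atlas (Coord n) M)
    {u : FrameBundle n M} (hu : u.base ∈ e.source) (hu' : u.base ∈ e'.source) :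
    S.frameFormIn α e' u = S.frameFormIn α e u := by
  ext1 Y
  rw [S.frameFormIn_eq α he hu, S.frameFormIn_eq α he' hu', frameDeriv_transition he he' hu hu',
    matrixIn_transition he he' hu hu']
  refine inverse_comp_eq_of_comp_eq (matrixIn_isInvertible he hu)
    (matrixIn_transition he he' hu hu' ▸ matrixIn_isInvertible he' hu') ?_
  ext1 ξ
  have := S.connectionForm_transition α he he' hu hu' (frameDeriv e he u Y).1 (matrixIn e u ξ)
  simp only [add_apply, ContinuousLinearMap.comp_apply, map_add, this]
  abel

/-- `frameForm` switches charts from point to point; gluing gives a single formula over a fixed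
chart domain, which can then be differentiated. -/
theorem frameForm_eq (he : e ∈ atlas (Coord n) M) {u : FrameBundle n M}
    (hu : u.base ∈ e.source) (Y : Tan u) :
    S.frameForm α u Y = (matrixIn e u).inverse ∘L
      (S.connectionForm α e (e u.base) (frameDeriv e he u Y).1 ∘L matrixIn e u +
        (frameDeriv e he u Y).2) := by
  rw [← S.frameFormIn_eq α he hu, frameForm,
    S.frameFormIn_eq_frameFormIn α he (chart_mem_atlas _ _) hu (mem_chart_source _ _)]

theorem mem_horizontal_iff (he : e ∈ atlas (Coord n) M) {u : FrameBundle n M}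
    (hu : u.base ∈ e.source) (Y : Tan u) :
    Y ∈ S.horizontal α u ↔ (frameDeriv e he u Y).2 =
      -(S.connectionForm α e (e u.base) (frameDeriv e he u Y).1 ∘L matrixIn e u) := by
  change S.frameForm α u Y = 0 ↔ _
  rw [S.frameForm_eq α he hu]
  have hA := matrixIn_isInvertible he hu
  rw [eq_neg_iff_add_eq_zero, add_comm]
  constructor
  · intro h
    ext1 ξ
    have := congrArg (matrixIn e u) (DFunLike.congr_fun h ξ)
    rw [ContinuousLinearMap.comp_apply, hA.self_apply_inverse] at this
    simpa using this
  · intro h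
    rw [h, ContinuousLinearMap.comp_zero]

theorem exists_mem_horizontal (he : e ∈ atlas (Coord n) M) {u : FrameBundle n M}
    (hu : u.base ∈ e.source) (y : Coord n) :
    ∃ Y ∈ S.horizontal α u, (frameDeriv e he u Y).1 = y := by
  obtain ⟨Y, hY⟩ := (frameDeriv_bijective he hu).2
    (y, -(S.connectionForm α e (e u.base) y ∘L matrixIn e u))
  exact ⟨Y, (S.mem_horizontal_iff α he hu Y).2 (by rw [hY]), by rw [hY]⟩

theorem projDiff_eq_iff (he : e ∈ atlas (Coord n) M) {u : FrameBundle n M}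
    (hu : u.base ∈ e.source) (Y : Tan u) (A : TangentSpace (𝓡 n) u.base) :
    projDiff u Y = A ↔ (frameDeriv e he u Y).1 = chartDeriv e u.base A := by
  rw [← chartDeriv_projDiff he hu]
  exact (chartDeriv_bijective he hu).1.eq_iff.symm

/-- Existence of a horizontal vector over each base vector gives the choice in `horLift`, and then
the one in `horPart`, its intended properties. -/
theorem horLift_spec (u : FrameBundle n M) (A : TangentSpace (𝓡 n) u.base) :
    S.horLift α u A ∈ S.horizontal α u ∧ projDiff u (S.horLift α u A) = A := by
  have hu := mem_chart_source (Coord n) u.base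
  have he := chart_mem_atlas (Coord n) u.base
  obtain ⟨Y, hY, hY'⟩ := S.exists_mem_horizontal α he hu (chartDeriv _ u.base A)
  exact Classical.epsilon_spec (p := fun Z => Z ∈ S.horizontal α u ∧ projDiff u Z = A)
    ⟨Y, hY, (projDiff_eq_iff he hu Y A).2 hY'⟩

theorem horPart_spec (u : FrameBundle n M) (Y : Tan u) :
    S.horPart α u Y ∈ S.horizontal α u ∧ projDiff u (S.horPart α u Y) = projDiff u Y := by
  have h : S.horPart α u Y ∈ S.horizontal α u ∧ Y - S.horPart α u Y ∈ vertical u := by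
    refine Classical.epsilon_spec (p := fun Z => Z ∈ S.horizontal α u ∧ Y - Z ∈ vertical u)
      ⟨S.horLift α u (projDiff u Y), (S.horLift_spec α u _).1, ?_⟩
    change projDiff u (Y - S.horLift α u (projDiff u Y)) = 0
    rw [map_sub, (S.horLift_spec α u _).2, sub_self]
  refine ⟨h.1, ?_⟩
  have h2 : projDiff u (Y - S.horPart α u Y) = 0 := h.2
  rw [map_sub, sub_eq_zero] at h2
  exact h2.symm

/-- The chart components of the canonical form are `A⁻¹ dx`. -/
theorem canonicalForm_chart (u : FrameBundle n M) (a : Coord n × Gl n) :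
    ∀ᶠ z in 𝓝 (chartAt (Coord n × Gl n) u u),
      canonicalForm ((chartAt (Coord n × Gl n) u).symm z) (mfderiv 𝓘(ℝ, Coord n × Gl n)
        𝓘(ℝ, Coord n × Gl n) (chartAt (Coord n × Gl n) u).symm z a) = z.2.inverse a.1 := by
  have he := chart_mem_atlas (Coord n) u.base
  rw [chartAt_eq_frameChart]
  set e := chartAt (Coord n) u.base
  have hu : u ∈ (frameChart e he).source := mem_chart_source (Coord n) u.base
  filter_upwards [(frameChart e he).open_target.mem_nhds ((frameChart e he).map_source hu)]
    with z hz
  have h1 := (frameChart e he).right_inv hz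
  rw [frameChart_apply] at h1
  rw [canonicalForm_eq he ((frameChart e he).map_target hz), frameDeriv_mfderiv_symm he hz]
  congr 2
  exact congrArg Prod.snd h1

/-- The chart components of the connection form are `A⁻¹ (ω A + dA)`. -/
theorem frameForm_chart (u : FrameBundle n M) (a : Coord n × Gl n) :
    ∀ᶠ z in 𝓝 (chartAt (Coord n × Gl n) u u),
      S.frameForm α ((chartAt (Coord n × Gl n) u).symm z) (mfderiv 𝓘(ℝ, Coord n × Gl n)
        𝓘(ℝ, Coord n × Gl n) (chartAt (Coord n × Gl n) u).symm z a) =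
        z.2.inverse ∘L (S.connectionForm α (chartAt (Coord n) u.base) z.1 a.1 ∘L z.2 + a.2) := by
  have he := chart_mem_atlas (Coord n) u.base
  rw [chartAt_eq_frameChart]
  set e := chartAt (Coord n) u.base
  have hu : u ∈ (frameChart e he).source := mem_chart_source (Coord n) u.base
  filter_upwards [(frameChart e he).open_target.mem_nhds ((frameChart e he).map_source hu)]
    with z hz
  have h1 := (frameChart e he).right_inv hz
  rw [frameChart_apply] at h1
  have h2 : e ((frameChart e he).symm z).base = z.1 := congrArg Prod.fst h1
  have h3 : matrixIn e ((frameChart e he).symm z) = z.2 := congrArg Prod.snd h1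
  rw [S.frameForm_eq α he ((frameChart e he).map_target hz), frameDeriv_mfderiv_symm he hz, h2, h3]

/-- Differentiating `A⁻¹ dx` gives `-A⁻¹ dA A⁻¹ dx`. Inserting `dA = -ω(dx) A` leaves `A⁻¹(ω(y)z -
ω(z)y)`, with `y`, `z` the base components, and `ω` is symmetric. -/
theorem torsionForm_eq_zero (u : FrameBundle n M) (Y Z : Tan u) : S.torsionForm α u Y Z = 0 := by
  have he := chart_mem_atlas (Coord n) u.base
  have hu := mem_chart_source (Coord n) u.base
  have hA := matrixIn_isInvertible he hu
  obtain ⟨D, hD, hD'⟩ := hasFDerivAt_inverse hA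
  have hg (a : Coord n × Gl n) : HasFDerivAt
      (fun z : Coord n × Gl n => z.2.inverse a.1)
      ((ContinuousLinearMap.apply ℝ (Coord n) a.1) ∘L D ∘L ContinuousLinearMap.snd ℝ _ _)
      (chartAt (Coord n × Gl n) u u) :=
    (ContinuousLinearMap.apply ℝ (Coord n) a.1).hasFDerivAt.comp _
      (HasFDerivAt.comp (g := ContinuousLinearMap.inverse) (f := Prod.snd)
        (chartAt (Coord n × Gl n) u u) hD hasFDerivAt_snd)
  rw [torsionForm, dOneForm_eq (canonicalForm_chart u) hg]
  have hY := (S.mem_horizontal_iff α he hu _).1 (S.horPart_spec α u Y).1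
  have hZ := (S.mem_horizontal_iff α he hu _).1 (S.horPart_spec α u Z).1
  change (D (frameDeriv _ he u (S.horPart α u Y)).2) (frameDeriv _ he u (S.horPart α u Z)).1 -
    (D (frameDeriv _ he u (S.horPart α u Z)).2) (frameDeriv _ he u (S.horPart α u Y)).1 = 0
  rw [hY, hZ, hD', hD']
  simp only [neg_apply, ContinuousLinearMap.comp_apply, map_neg, neg_neg, hA.self_apply_inverse]
  rw [S.connectionForm_symm α he ((chartAt (Coord n) u.base).map_source hu), sub_self]

/-- On horizontal vectors the derivative of `ω` gives `dω`, and the term `ω dA` with `dA = -ω(dx) A`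
gives the commutator. -/
theorem curvatureForm_eq (u : FrameBundle n M) (Y Z : Tan u) :
    S.curvatureForm α u Y Z = (matrixIn (chartAt (Coord n) u.base) u).inverse ∘L
      S.chartCurvature α (chartAt (Coord n) u.base) (chartAt (Coord n) u.base u.base)
        (chartDeriv (chartAt (Coord n) u.base) u.base (projDiff u Y))
        (chartDeriv (chartAt (Coord n) u.base) u.base (projDiff u Z)) ∘L
      matrixIn (chartAt (Coord n) u.base) u := by
  have he := chart_mem_atlas (Coord n) u.base
  have hu := mem_chart_source (Coord n) u.base
  have hA := matrixIn_isInvertible he hu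
  obtain ⟨hY, hY'⟩ := S.horPart_spec α u Y
  obtain ⟨hZ, hZ'⟩ := S.horPart_spec α u Z
  rw [← hY', ← hZ', chartDeriv_projDiff he hu, chartDeriv_projDiff he hu]
  rw [S.mem_horizontal_iff α he hu] at hY hZ
  rw [curvatureForm]
  generalize S.horPart α u Y = Y at hY ⊢
  generalize S.horPart α u Z = Z at hZ ⊢
  have hg := hasFDerivAt_inverse_comp
    (z := (chartAt (Coord n) u.base u.base, matrixIn (chartAt (Coord n) u.base) u))
    (S.connectionForm_differentiableAt α he ((chartAt (Coord n) u.base).map_source hu)) hA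
  choose D hD hD' using hg
  rw [dOneForm_eq (S.frameForm_chart α u) hD]
  change D (frameDeriv _ he u Z) (frameDeriv _ he u Y) -
    D (frameDeriv _ he u Y) (frameDeriv _ he u Z) = _
  rw [hD' _ hZ, hD' _ hY, hY, hZ, chartCurvature_apply]
  ext1 ξ
  simp only [sub_apply, add_apply, neg_apply, ContinuousLinearMap.comp_apply, map_add, map_sub,
    map_neg]
  abel

/-- A frame at `q`. -/
theorem exists_frame (q : M) : ∃ u : FrameBundle n M, u.base = q :=
  ⟨⟨q, ((chart_mdifferentiable (chart_mem_atlas (Coord n) q)).mfderiv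
    (mem_chart_source (Coord n) q)).symm⟩, rfl⟩

theorem curvature_tfae : List.TFAE [
    ∀ q : M, S.chartCurvature α (chartAt (Coord n) q) (chartAt (Coord n) q q) = 0,
    ∀ (u : FrameBundle n M) (A B C : TangentSpace (𝓡 n) u.base), S.curvatureTensor α u A B C = 0,
    ∀ (u : FrameBundle n M) (Y Z : Tan u), S.curvatureForm α u Y Z = 0] := by
  tfae_have 1 → 3 := fun h u Y Z => by
    rw [curvatureForm_eq, h]
    simp
  tfae_have 3 → 2 := fun h u A B C => by
    rw [curvatureTensor, h, zero_apply, map_zero]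
  tfae_have 2 → 1 := fun h q => by
    obtain ⟨u, rfl⟩ := exists_frame (n := n) q
    have he := chart_mem_atlas (Coord n) u.base
    have hu := mem_chart_source (Coord n) u.base
    have hA := matrixIn_isInvertible he hu
    ext1 v
    ext1 w
    ext1 ξ
    obtain ⟨A, rfl⟩ := (chartDeriv_bijective he hu).2 v
    obtain ⟨B, rfl⟩ := (chartDeriv_bijective he hu).2 w
    -- The third argument is chosen so that its coordinate vector in the chart is `ξ`.
    have h1 := h u A B (u.frame ((matrixIn (chartAt (Coord n) u.base) u).inverse ξ))
    rw [curvatureTensor, map_eq_zero_iff _ u.frame.injective, curvatureForm_eq,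
      (S.horLift_spec α u A).2, (S.horLift_spec α u B).2,
      ContinuousLinearEquiv.symm_apply_apply] at h1
    have h2 := congrArg (matrixIn (chartAt (Coord n) u.base) u) h1
    simpa [hA.self_apply_inverse] using h2
  tfae_finish

/-! ### Horizontal curves and geodesics. -/

theorem hasFDerivAt_frameChart_comp (he : e ∈ atlas (Coord n) M) {c : ℝ → FrameBundle n M} {s : ℝ}
    (hc : MDifferentiableAt 𝓘(ℝ, ℝ) 𝓘(ℝ, Coord n × Gl n) c s) (hs : (c s).base ∈ e.source) :
    HasFDerivAt (frameChart e he ∘ c)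
      (frameDeriv e he (c s) ∘L mfderiv 𝓘(ℝ, ℝ) 𝓘(ℝ, Coord n × Gl n) c s) s :=
  (HasMFDerivAt.comp s ((frameChart_mdifferentiable he).mdifferentiableAt
      ((mem_frameChart_source he (c s)).2 hs)).hasMFDerivAt hc.hasMFDerivAt).hasFDerivAt

theorem hasDerivAt_matrixIn (he : e ∈ atlas (Coord n) M) {c : ℝ → FrameBundle n M} {s : ℝ}
    (hc : MDifferentiableAt 𝓘(ℝ, ℝ) 𝓘(ℝ, Coord n × Gl n) c s) (hs : (c s).base ∈ e.source) :
    HasDerivAt (fun r => matrixIn e (c r))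
      (frameDeriv e he (c s) (FrameBundle.velocity c s)).2 s :=
  ((ContinuousLinearMap.snd ℝ (Coord n) (Gl n)).hasFDerivAt.comp s
    (hasFDerivAt_frameChart_comp he hc hs)).hasDerivAt

theorem hasDerivAt_base (he : e ∈ atlas (Coord n) M) {c : ℝ → FrameBundle n M} {s : ℝ}
    (hc : MDifferentiableAt 𝓘(ℝ, ℝ) 𝓘(ℝ, Coord n × Gl n) c s) (hs : (c s).base ∈ e.source) :
    HasDerivAt (fun r => e (c r).base)
      (frameDeriv e he (c s) (FrameBundle.velocity c s)).1 s :=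
  ((ContinuousLinearMap.fst ℝ (Coord n) (Gl n)).hasFDerivAt.comp s
    (hasFDerivAt_frameChart_comp he hc hs)).hasDerivAt

/-- The derivative of the canonical form of the velocity along a horizontal curve `c` with coordinate projection `x`. -/
theorem hasDerivAt_canonicalForm_velocity (he : e ∈ atlas (Coord n) M)
    {c : ℝ → FrameBundle n M} {x : ℝ → Coord n} {t : ℝ}
    (hc : ∀ᶠ s in 𝓝 t, MDifferentiableAt 𝓘(ℝ, ℝ) 𝓘(ℝ, Coord n × Gl n) c s ∧
      (c s).base ∈ e.source)
    (hx : (fun r => e (c r).base) =ᶠ[𝓝 t] x) (hx' : ContDiffAt ℝ ∞ x t)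
    (hhor : FrameBundle.velocity c t ∈ S.horizontal α (c t)) :
    HasDerivAt (fun s => canonicalForm (c s) (FrameBundle.velocity c s))
      ((matrixIn e (c t)).inverse (deriv (deriv x) t +
        S.connectionForm α e (e (c t).base) (deriv x t) (deriv x t))) t := by
  obtain ⟨hct, hbt⟩ := hc.self_of_nhds
  have hA := matrixIn_isInvertible he hbt
  obtain ⟨D, hD, hD'⟩ := hasFDerivAt_inverse hA
  have hfst : ∀ᶠ s in 𝓝 t, (frameDeriv e he (c s) (FrameBundle.velocity c s)).1 = deriv x s := by
    filter_upwards [hc, hx.eventuallyEq_nhds] with s hs hxs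
    rw [← hxs.deriv_eq, (hasDerivAt_base he hs.1 hs.2).deriv]
  have hθ : (fun s => canonicalForm (c s) (FrameBundle.velocity c s)) =ᶠ[𝓝 t]
      fun s => (matrixIn e (c s)).inverse (deriv x s) := by
    filter_upwards [hc, hfst] with s hs hs'
    rw [canonicalForm_eq he hs.2, hs']
  have hmat : HasDerivAt (fun s => (matrixIn e (c s)).inverse)
      (D (frameDeriv e he (c t) (FrameBundle.velocity c t)).2) t :=
    HasFDerivAt.comp_hasDerivAt (l := ContinuousLinearMap.inverse) t hD
      (hasDerivAt_matrixIn he hct hbt)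
  have hmain := (hmat.clm_apply (hasDerivAt_deriv hx')).congr_of_eventuallyEq hθ
  convert! hmain using 1
  -- Horizontality reads `A' = -ω(x') A`, so `(A⁻¹)' x' = -A⁻¹ A' A⁻¹ x' = A⁻¹ ω(x') x'`.
  rw [(S.mem_horizontal_iff α he hbt _).1 hhor, hfst.self_of_nhds, hD', map_add, add_comm]
  congr 1
  simp only [neg_apply, ContinuousLinearMap.comp_apply, hA.self_apply_inverse, map_neg, neg_neg]

/-- The derivative of `θ(c')` always exists and is `A⁻¹` applied to the coordinates of `∇_{γ'}γ'`;
injectivity of `A⁻¹` gives both directions. -/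
theorem geodesic_iff {J : Set ℝ} (hJ : IsOpen J) {γ : ℝ → M} {c : ℝ → FrameBundle n M}
    (hγ : ContMDiffOn 𝓘(ℝ, ℝ) (𝓡 n) ∞ γ J) (hc : S.IsHorizontalLiftOn α c γ J) {t : ℝ}
    (ht : t ∈ J) : S.nablaVelocity α γ t = 0 ↔
      HasDerivAt (fun s => canonicalForm (c s) (FrameBundle.velocity c s)) 0 t := by
  have he := chart_mem_atlas (Coord n) (γ t)
  have hu := mem_chart_source (Coord n) (γ t)
  set e := chartAt (Coord n) (γ t)
  have hev : ∀ᶠ s in 𝓝 t, MDifferentiableAt 𝓘(ℝ, ℝ) 𝓘(ℝ, Coord n × Gl n) c s ∧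
      (c s).base ∈ e.source := by
    filter_upwards [hJ.mem_nhds ht, (hγ.continuousOn.continuousAt
      (hJ.mem_nhds ht)).preimage_mem_nhds (e.open_source.mem_nhds hu)] with s h1 h2
    refine ⟨(hc.smooth.contMDiffAt (hJ.mem_nhds h1)).mdifferentiableAt (by simp), ?_⟩
    rw [hc.base_eq s h1]
    exact h2
  have hbase : (fun r => e (c r).base) =ᶠ[𝓝 t] e ∘ γ := by
    filter_upwards [hJ.mem_nhds ht] with r hr
    rw [hc.base_eq r hr]
    rfl
  have hval := S.hasDerivAt_canonicalForm_velocity α he hev hbase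
    (comp_chart_contDiffAt he (hγ.contMDiffAt (hJ.mem_nhds ht)) hu) (hc.horizontal t ht)
  have hA := matrixIn_isInvertible he hev.self_of_nhds.2
  rw [hc.base_eq t ht] at hval
  rw [S.nablaVelocity_eq_zero_iff α he hJ hγ ht hu]
  constructor
  · intro h
    rw [h, map_zero] at hval
    exact hval
  · intro h
    have h1 := congrArg (matrixIn e (c t)) (hval.unique h)
    rwa [hA.self_apply_inverse, map_zero] at h1

end StatisticalManifold
end AlphaFrame

theorem corollary5p10 {n : ℕ} {M : Type*} [TopologicalSpace M] [T2Space M]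
    [ChartedSpace (AlphaFrame.Coord n) M] [IsManifold (𝓡 n) ∞ M]
    {X : Type*} [MeasurableSpace X] {μ : Measure X}
    (S : AlphaFrame.StatisticalManifold n M μ) (α : ℝ) :
    -- geodesics, for every horizontal lift of the curve
    (∀ (ε : ℝ), 0 < ε → ∀ (γ : ℝ → M) (c : ℝ → AlphaFrame.FrameBundle n M),
      ContMDiffOn 𝓘(ℝ, ℝ) (𝓡 n) ∞ γ (Ioo (-ε) ε) →
      S.IsHorizontalLiftOn α c γ (Ioo (-ε) ε) →
      (S.IsGeodesicOn α γ (Ioo (-ε) ε) ↔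
        ∀ t ∈ Ioo (-ε) ε, HasDerivAt
          (fun s => AlphaFrame.FrameBundle.canonicalForm (c s)
            (AlphaFrame.FrameBundle.velocity c s)) 0 t)) ∧
    -- torsion
    List.TFAE [
      S.TorsionFree α,
      ∀ (u : AlphaFrame.FrameBundle n M) (A B : TangentSpace (𝓡 n) u.base),
        S.torsionTensor α u A B = 0,
      ∀ (u : AlphaFrame.FrameBundle n M) (Y Z : AlphaFrame.FrameBundle.Tan u),
        S.torsionForm α u Y Z = 0] ∧
    -- curvature
    List.TFAE [
      S.Flat α,
      ∀ A B C : (q : M) → TangentSpace (𝓡 n) q, AlphaFrame.StatisticalManifold.IsSmoothField A →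
        AlphaFrame.StatisticalManifold.IsSmoothField B →
        AlphaFrame.StatisticalManifold.IsSmoothField C → ∀ q, S.curvature α A B C q = 0,
      ∀ (u : AlphaFrame.FrameBundle n M) (A B C : TangentSpace (𝓡 n) u.base),
        S.curvatureTensor α u A B C = 0,
      ∀ (u : AlphaFrame.FrameBundle n M) (Y Z : AlphaFrame.FrameBundle.Tan u),
        S.curvatureForm α u Y Z = 0] := by
  refine ⟨fun ε _ γ c hγ hc => ?_, ?_, ?_⟩
  · exact forall₂_congr fun t ht => S.geodesic_iff α isOpen_Ioo hγ hc ht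
  · tfae_have 1 → 3 := fun _ => S.torsionForm_eq_zero α
    tfae_have 3 → 2 := fun h u A B => by
      rw [AlphaFrame.StatisticalManifold.torsionTensor, h, map_zero]
    tfae_have 2 → 1 := fun _ => S.torsionFree α
    tfae_finish
  · have h1 := S.flat_tfae α
    have h2 := S.curvature_tfae α
    tfae_have 1 ↔ 2 := h1.out 0 1
    -- The two lists meet in the vanishing of `chartCurvature` in the preferred chart at each point.
    tfae_have 1 ↔ 3 := (h1.out 0 2).trans (h2.out 0 1)
    tfae_have 3 ↔ 4 := h2.out 1 2
    tfae_finish
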